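/- Consider a discrete memoryless state-dependent Z-interference channel with finite alphabets: the state pairs $(S_{1,i},S_{2,i})$ are i.i.d. with law $P_{S_1S_2}$, and the outputs are drawn, independently over channel uses, from $P_{Y_1|S_1X_1X_2}P_{Y_2|S_2X_2}$. Both encoders know both state sequences noncausally: encoder $k$ maps $(w_k,s_1^n,s_2^n)$ to $x_k^n$, and decoder $k$ maps $y_k^n$ to $\hat w_k$. A pair of nonnegative rates $(R_1,R_2)$ is called achievable if there are codes of length $n=0,1,2,\dots$ with $\lceil 2^{nR_1}\rceil$ and $\lceil 2^{nR_2}\rceil$ messages such that the average probability (over uniform messages) of the event $(\hat w_1,\hat w_2)\neq(w_1,w_2)$ tends to $0$ as $n\to\infty$; the capacity region is the closure of the set of achievable pairs. Let $U,V$ be auxiliary random variables with arbitrary finite alphabets and let $(S_1,S_2,U,X_1,V,X_2,Y_1,Y_2)$ have any joint distribution of the form $$P_{S_1S_2}\,P_{U|S_1S_2}\,P_{X_1|US_1S_2}\,P_{V|S_2}\,P_{X_2|VS_2}\,P_{Y_1|S_1X_1X_2}\,P_{Y_2|S_2X_2}.$$ With mutual informations in bits, the region of all pairs $R_1,R_2\ge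 0$ satisfying $$R_1\le I(U;VY_1)-I(S_1S_2;U),\qquad R_2\le \min\{I(V;Y_2),I(V;Y_1)\}-I(S_2;V)$$ is achievable: it is contained in the capacity region, and every pair $R_1,R_2\ge 0$ satisfying both inequalities strictly is achievable. If moreover $I(V;Y_2)\le I(V;Y_1)$, then the same two assertions hold with the second inequality replaced by $R_2\le I(V;Y_2)-I(S_2;V)$. -/

import Mathlib

open Filter Topology

noncomputable section

/-! ### Discrete information measures -/

/-- The probability that the random variable `A` takes the value `a`, where `P` is a probability
mass function on the finite sample space `Ω`. -/
def probEq {Ω α : Type*} [Fintype Ω] (P : stdSimplex ℝ Ω) (A : Ω → α) (a : α) : ℝ :=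
  open Classical in ∑ ω, if A ω = a then P ω else 0

/-- The mutual information `I(A;B)` in bits of two finitely valued random variables on the
finite probability space `(Ω, P)`.  Terms with `P(A=a, B=b) = 0` contribute `0`. -/
def mutualInfo {Ω α β : Type*} [Fintype Ω] [Fintype α] [Fintype β]
    (P : stdSimplex ℝ Ω) (A : Ω → α) (B : Ω → β) : ℝ :=
  ∑ a, ∑ b, probEq P (fun ω => (A ω, B ω)) (a, b) *
    Real.logb 2 (probEq P (fun ω => (A ω, B ω)) (a, b) / (probEq P A a * probEq P B b))

/-! ### The channel, codes, and the capacity region -/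

/-- A discrete memoryless state-dependent Z-interference channel with finite alphabets: the joint
law `P_{S₁S₂}` of one pair of states, and the one-letter transition laws
`P_{Y₁|S₁X₁X₂}` and `P_{Y₂|S₂X₂}`. -/
structure StateZIC (S₁ S₂ X₁ X₂ Y₁ Y₂ : Type*) [Fintype S₁] [Fintype S₂]
    [Fintype Y₁] [Fintype Y₂] where
  state : stdSimplex ℝ (S₁ × S₂)
  chan₁ : S₁ → X₁ → X₂ → stdSimplex ℝ Y₁
  chan₂ : S₂ → X₂ → stdSimplex ℝ Y₂

/-- A code of length `n` with `M₁` and `M₂` messages.  Both encoders know both state sequences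
noncausally; the decoders only see their own output sequences. -/
structure ZICCode (S₁ S₂ X₁ X₂ Y₁ Y₂ : Type*) (n M₁ M₂ : ℕ) where
  enc₁ : Fin M₁ → (Fin n → S₁) → (Fin n → S₂) → (Fin n → X₁)
  enc₂ : Fin M₂ → (Fin n → S₁) → (Fin n → S₂) → (Fin n → X₂)
  dec₁ : (Fin n → Y₁) → Fin M₁
  dec₂ : (Fin n → Y₂) → Fin M₂

namespace StateZIC

variable {S₁ S₂ X₁ X₂ Y₁ Y₂ : Type*} [Fintype S₁] [Fintype S₂] [Fintype X₁] [Fintype X₂]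
  [Fintype Y₁] [Fintype Y₂]

/-- The probability that `(ŵ₁, ŵ₂) ≠ (w₁, w₂)` when the messages `w₁, w₂` are sent; the pairs of
states are i.i.d. and the channel is used without memory. -/
def condErrorProb (ch : StateZIC S₁ S₂ X₁ X₂ Y₁ Y₂) {n M₁ M₂ : ℕ}
    (c : ZICCode S₁ S₂ X₁ X₂ Y₁ Y₂ n M₁ M₂) (w₁ : Fin M₁) (w₂ : Fin M₂) : ℝ :=
  ∑ s₁ : Fin n → S₁, ∑ s₂ : Fin n → S₂, (∏ i, ch.state (s₁ i, s₂ i)) *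
    ∑ y₁ : Fin n → Y₁, ∑ y₂ : Fin n → Y₂,
      (∏ i, ch.chan₁ (s₁ i) (c.enc₁ w₁ s₁ s₂ i) (c.enc₂ w₂ s₁ s₂ i) (y₁ i)) *
      (∏ i, ch.chan₂ (s₂ i) (c.enc₂ w₂ s₁ s₂ i) (y₂ i)) *
      (if (c.dec₁ y₁, c.dec₂ y₂) ≠ (w₁, w₂) then 1 else 0)

/-- The average probability of error of a code. -/
def errorProb (ch : StateZIC S₁ S₂ X₁ X₂ Y₁ Y₂) {n M₁ M₂ : ℕ}
    (c : ZICCode S₁ S₂ X₁ X₂ Y₁ Y₂ n M₁ M₂) : ℝ :=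
  1 / ((M₁ : ℝ) * (M₂ : ℝ)) * ∑ w₁, ∑ w₂, ch.condErrorProb c w₁ w₂

/-- The (nonnegative) rate pair `(R₁, R₂)` is achievable: there are codes of every length `n` with
`2 ^ (n R₁)` and `2 ^ (n R₂)` messages (rounded up to integers), whose average probability of
error tends to `0`. -/
def Achievable (ch : StateZIC S₁ S₂ X₁ X₂ Y₁ Y₂) (R₁ R₂ : ℝ) : Prop :=
  0 ≤ R₁ ∧ 0 ≤ R₂ ∧
    ∃ c : ∀ n : ℕ, ZICCode S₁ S₂ X₁ X₂ Y₁ Y₂ n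
        ⌈(2 : ℝ) ^ ((n : ℝ) * R₁)⌉₊ ⌈(2 : ℝ) ^ ((n : ℝ) * R₂)⌉₊,
      Tendsto (fun n => ch.errorProb (c n)) atTop (𝓝 0)

/-- The capacity region: the closure of the set of achievable rate pairs. -/
def capacityRegion (ch : StateZIC S₁ S₂ X₁ X₂ Y₁ Y₂) : Set (ℝ × ℝ) :=
  closure {R : ℝ × ℝ | ch.Achievable R.1 R.2}

end StateZIC

/-! ### Auxiliary random variables -/

/-- The conditional laws `P_{U|S₁S₂}`, `P_{X₁|US₁S₂}`, `P_{V|S₂}`, `P_{X₂|VS₂}` with finite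
auxiliary alphabets `U` and `V`. -/
structure ZICInput (S₁ S₂ X₁ X₂ U V : Type*) [Fintype X₁] [Fintype X₂]
    [Fintype U] [Fintype V] where
  pU : S₁ → S₂ → stdSimplex ℝ U
  pX₁ : U → S₁ → S₂ → stdSimplex ℝ X₁
  pV : S₂ → stdSimplex ℝ V
  pX₂ : V → S₂ → stdSimplex ℝ X₂

namespace ZICInput

variable {S₁ S₂ X₁ X₂ Y₁ Y₂ U V : Type*} [Fintype S₁] [Fintype S₂] [Fintype X₁] [Fintype X₂]
  [Fintype Y₁] [Fintype Y₂] [Fintype U] [Fintype V]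

/-- The joint law
`P_{S₁S₂} P_{U|S₁S₂} P_{X₁|US₁S₂} P_{V|S₂} P_{X₂|VS₂} P_{Y₁|S₁X₁X₂} P_{Y₂|S₂X₂}`
of `(S₁, S₂, U, X₁, V, X₂, Y₁, Y₂)`. -/
def joint (q : ZICInput S₁ S₂ X₁ X₂ U V) (ch : StateZIC S₁ S₂ X₁ X₂ Y₁ Y₂) :
    stdSimplex ℝ (S₁ × S₂ × U × X₁ × V × X₂ × Y₁ × Y₂) :=
  ⟨fun (s₁, s₂, u, x₁, v, x₂, y₁, y₂) =>
      ch.state (s₁, s₂) * (q.pU s₁ s₂ u * (q.pX₁ u s₁ s₂ x₁ * (q.pV s₂ v * (q.pX₂ v s₂ x₂ *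
        (ch.chan₁ s₁ x₁ x₂ y₁ * ch.chan₂ s₂ x₂ y₂))))), by
    constructor
    · rintro ⟨s₁, s₂, u, x₁, v, x₂, y₁, y₂⟩
      exact mul_nonneg (ch.state.2.1 _) (mul_nonneg ((q.pU _ _).2.1 _)
        (mul_nonneg ((q.pX₁ _ _ _).2.1 _) (mul_nonneg ((q.pV _).2.1 _)
          (mul_nonneg ((q.pX₂ _ _).2.1 _)
            (mul_nonneg ((ch.chan₁ _ _ _).2.1 _) ((ch.chan₂ _ _).2.1 _))))))
    · have h := stdSimplex.sum_eq_one ch.state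
      rw [Fintype.sum_prod_type] at h
      simp [Fintype.sum_prod_type, ← Finset.mul_sum, stdSimplex.sum_eq_one, h]⟩

/-- `I(U;VY₁)`. -/
def infoU_VY₁ (q : ZICInput S₁ S₂ X₁ X₂ U V) (ch : StateZIC S₁ S₂ X₁ X₂ Y₁ Y₂) : ℝ :=
  mutualInfo (q.joint ch) (fun (_, _, u, _, _, _, _, _) => u)
    (fun (_, _, _, _, v, _, y₁, _) => (v, y₁))

/-- `I(S₁S₂;U)`. -/
def infoS₁S₂_U (q : ZICInput S₁ S₂ X₁ X₂ U V) (ch : StateZIC S₁ S₂ X₁ X₂ Y₁ Y₂) : ℝ :=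
  mutualInfo (q.joint ch) (fun (s₁, s₂, _, _, _, _, _, _) => (s₁, s₂))
    (fun (_, _, u, _, _, _, _, _) => u)

/-- `I(V;Y₁)`. -/
def infoV_Y₁ (q : ZICInput S₁ S₂ X₁ X₂ U V) (ch : StateZIC S₁ S₂ X₁ X₂ Y₁ Y₂) : ℝ :=
  mutualInfo (q.joint ch) (fun (_, _, _, _, v, _, _, _) => v)
    (fun (_, _, _, _, _, _, y₁, _) => y₁)

/-- `I(V;Y₂)`. -/
def infoV_Y₂ (q : ZICInput S₁ S₂ X₁ X₂ U V) (ch : StateZIC S₁ S₂ X₁ X₂ Y₁ Y₂) : ℝ :=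
  mutualInfo (q.joint ch) (fun (_, _, _, _, v, _, _, _) => v)
    (fun (_, _, _, _, _, _, _, y₂) => y₂)

/-- `I(S₂;V)`. -/
def infoS₂_V (q : ZICInput S₁ S₂ X₁ X₂ U V) (ch : StateZIC S₁ S₂ X₁ X₂ Y₁ Y₂) : ℝ :=
  mutualInfo (q.joint ch) (fun (_, s₂, _, _, _, _, _, _) => s₂)
    (fun (_, _, _, _, v, _, _, _) => v)

end ZICInput

end

/-!
The codebooks are families of independent standard exponential variables, one for each pair of a
codeword and a message.  To send `k`, the second encoder takes the codeword `v` that minimizes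
`T (v, k) / P(v|s₂)`, and the first encoder picks `u` in the same way from its own codebook with
the law `P(u|s₁,s₂)`.  Such a race of exponential clocks is won by `v` with
probability exactly `P(v|s₂)` (`ExpRace.codebook_wins_ge_le`), and the two races are independent.
The selected codewords, the states, the inputs and the outputs therefore have exactly the
prescribed joint law, so that neither typicality nor a Markov lemma is needed.

Decoding is by thresholds.  The second decoder looks for a pair `(v, k)` with `T (v, k) ≤ c v y₂`;
the first one looks for `(u, m)` and any `(v, k)` with `T (v, k) ≤ a v y₁` and
`T' (u, m) ≤ b u v y₁`, and outputs `m`, without having to find the right `(v, k)`.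
The winner's variable is exponential with mean `P(v|s₂)`, so it misses the threshold with
probability `exp (-(c / P(v|s₂)))`, while another codeword meets it with probability at most the
threshold (`ExpRace.codebook_wins_other_le`).  The union bound gives `exists_oneShot_code`, which
holds for arbitrary alphabets and hence for blocks of length `n`.

For blocks, the thresholds are `2 ^ (n A) P(v|y₁)`, `2 ^ (n B) P(u|v,y₁)` and
`2 ^ (n G) P(v|y₂)`.  The ratio of threshold and mean is then a product of `n` independent factors
whose expected logarithm is positive if `A > I(S₂;V) - I(V;Y₁)`, and similarly for `B` and `G`;
Chernoff's bound (`exists_expectation_exp_neg_prod_le`) shows that missed thresholds are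
exponentially unlikely.  Wrong messages are unlikely if `R₁ + B < 0`, `R₁ + B + R₂ + A < 0` and
`R₂ + G < 0` (`StateZIC.achievable_of_exponents`).  Rates strictly inside the region leave room for
such exponents.

On the boundary, the positive rates are lowered slightly and a rate equal to zero is kept: a user
with a single message can make no error.  If `R₂ = 0`, the exponent `A` may have to be slightly
positive, and the slack in `R₁` pays for it because the first decoder is only required to exclude
pairs in which its own message is wrong.
-/

open MeasureTheory ProbabilityTheory

/-! ### Exponential races -/

namespace ExpRace

/-- The exponential distribution with rate one. -/
noncomputable abbrev stdExp : Measure ℝ := expMeasure 1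

instance : IsProbabilityMeasure stdExp := isProbabilityMeasure_expMeasure one_pos

lemma setLIntegral_stdExp {A : Set ℝ} (hA : MeasurableSet A) (hpos : ∀ t ∈ A, 0 ≤ t)
    {f : ℝ → ENNReal} (hf : Measurable f) :
    ∫⁻ t in A, f t ∂stdExp = ∫⁻ t in A, ENNReal.ofReal (Real.exp (-t)) * f t := by
  have h : stdExp = volume.withDensity (exponentialPDF 1) := rfl
  have hm : Measurable (exponentialPDF 1) := (measurable_exponentialPDFReal 1).ennreal_ofReal
  rw [h, setLIntegral_withDensity_eq_setLIntegral_mul _ hm hf hA]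
  refine setLIntegral_congr_fun hA fun t ht => ?_
  simp [exponentialPDF_of_nonneg (hpos t ht)]

lemma setLIntegral_Ici_exp {s x : ℝ} (hs : 0 < s) :
    ∫⁻ t in Set.Ici x, ENNReal.ofReal (Real.exp (-(s * t)))
      = ENNReal.ofReal (Real.exp (-(s * x)) / s) := by
  rw [setLIntegral_congr Ioi_ae_eq_Ici.symm, ← ofReal_integral_eq_lintegral_ofReal]
  · congr 1
    have := integral_exp_mul_Ioi (a := -s) (by linarith) x
    simp only [neg_mul] at this
    rw [this]; field_simp
  · have := integrableOn_exp_mul_Ioi (a := -s) (by linarith) x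
    simpa only [neg_mul, IntegrableOn] using this
  · exact Filter.Eventually.of_forall fun t => (Real.exp_pos _).le

lemma stdExp_Ici_le {y : ℝ} (hy : 0 ≤ y) :
    stdExp (Set.Ici y) ≤ ENNReal.ofReal (Real.exp (-y)) := by
  have h := setLIntegral_stdExp (A := Set.Ici y) measurableSet_Ici (fun t ht => hy.trans ht)
    (f := fun _ => 1) measurable_const
  have h2 := setLIntegral_Ici_exp (s := 1) (x := y) one_pos
  simp only [one_mul, div_one] at h2
  simp only [mul_one, h2, setLIntegral_const, one_mul] at h
  exact h.le

lemma stdExp_Icc_le {l y : ℝ} (hl : 0 ≤ l) :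
    stdExp (Set.Icc l y) ≤ ENNReal.ofReal (y * Real.exp (-l)) := by
  have h := setLIntegral_stdExp (A := Set.Icc l y) measurableSet_Icc (fun t ht => hl.trans ht.1)
    (f := fun _ => 1) measurable_const
  simp only [mul_one, setLIntegral_const, one_mul] at h
  rw [h]
  calc ∫⁻ t in Set.Icc l y, ENNReal.ofReal (Real.exp (-t))
      ≤ ∫⁻ _ in Set.Icc l y, ENNReal.ofReal (Real.exp (-l)) :=
        setLIntegral_mono measurable_const fun t ht =>
          ENNReal.ofReal_le_ofReal (Real.exp_le_exp.2 (by linarith [ht.1]))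
    _ = ENNReal.ofReal (Real.exp (-l)) * ENNReal.ofReal (y - l) := by simp
    _ ≤ ENNReal.ofReal (Real.exp (-l)) * ENNReal.ofReal y := by gcongr; linarith
    _ = _ := by rw [← ENNReal.ofReal_mul (Real.exp_pos _).le, mul_comm]

/-- The coordinate `i` is integrated out last: if, given `T i = t`, every other coordinate `j` is
confined to a set of probability at most `C j * exp (-(a j * t))`, the event that moreover `T i ≥ x`
has probability at most `∏ C j` times the integral of `exp (-t) * exp (-(∑ a j) * t)` over
`t ≥ x`. -/
lemma measure_le_of_slices {ι : Type*} [Fintype ι] [DecidableEq ι] (i : ι) (x : ℝ) (hx : 0 ≤ x)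
    (B : ι → ℝ → Set ℝ) (C a : ι → ℝ) (hC : ∀ j, 0 ≤ C j) (ha : ∀ j, 0 ≤ a j)
    (hBm : ∀ j, MeasurableSet {p : ℝ × ℝ | p.2 ∈ B j p.1})
    (hB : ∀ j, j ≠ i → ∀ t, 0 ≤ t →
      stdExp (B j t) ≤ ENNReal.ofReal (C j * Real.exp (-(a j * t)))) :
    (Measure.pi fun _ : ι => stdExp) {T | x ≤ T i ∧ ∀ j, j ≠ i → T j ∈ B j (T i)}
      ≤ ENNReal.ofReal ((∏ j : {j // ¬ j = i}, C j) *
          (Real.exp (-((1 + ∑ j : {j // ¬ j = i}, a j) * x)) /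
            (1 + ∑ j : {j // ¬ j = i}, a j))) := by
  set s := 1 + ∑ j : {j // ¬ j = i}, a j with hs
  have hs0 : 0 < s := by
    have : 0 ≤ ∑ j : {j // ¬ j = i}, a j := Finset.sum_nonneg fun j _ => ha j
    linarith
  have hCp : 0 ≤ ∏ j : {j // ¬ j = i}, C j := Finset.prod_nonneg fun j _ => hC j
  let i' : {j // j = i} := ⟨i, rfl⟩
  let D : Set (({j // j = i} → ℝ) × ({j // ¬ j = i} → ℝ)) :=
    {p | x ≤ p.1 i' ∧ ∀ j : {j // ¬ j = i}, p.2 j ∈ B j (p.1 i')}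
  have hD : MeasurableSet D := by
    have hDeq : D = {p | x ≤ p.1 i'} ∩
        ⋂ j : {j // ¬ j = i}, (fun p => (p.1 i', p.2 j)) ⁻¹' {p : ℝ × ℝ | p.2 ∈ B j p.1} := by
      ext p; simp [D]
    rw [hDeq]
    refine MeasurableSet.inter (measurableSet_le measurable_const (by fun_prop))
      (MeasurableSet.iInter fun j => ?_)
    have hm : Measurable fun p : ({j // j = i} → ℝ) × ({j // ¬ j = i} → ℝ) =>
      (p.1 i', p.2 j) := by fun_prop
    exact hm (hBm j)
  have hmp := measurePreserving_piEquivPiSubtypeProd (fun _ : ι => stdExp) (fun j => j = i)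
  have hE : {T : ι → ℝ | x ≤ T i ∧ ∀ j, j ≠ i → T j ∈ B j (T i)}
      = (MeasurableEquiv.piEquivPiSubtypeProd (fun _ : ι => ℝ) (fun j => j = i)) ⁻¹' D := by
    ext T
    simp only [Set.mem_ofPred_eq, Set.mem_preimage, D]
    constructor
    · rintro ⟨h1, h2⟩
      exact ⟨h1, fun j => h2 j j.2⟩
    · rintro ⟨h1, h2⟩
      exact ⟨h1, fun j hj => h2 ⟨j, hj⟩⟩
  rw [hE, hmp.measure_preimage hD.nullMeasurableSet, Measure.prod_apply hD]
  let G : ℝ → ENNReal := (Set.Ici x).indicator fun t =>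
    ENNReal.ofReal ((∏ j : {j // ¬ j = i}, C j) * Real.exp (-((s - 1) * t)))
  have hG : Measurable G := Measurable.indicator (by fun_prop) measurableSet_Ici
  have hle : ∀ f : {j // j = i} → ℝ,
      (Measure.pi fun _ : {j // ¬ j = i} => stdExp) (Prod.mk f ⁻¹' D) ≤ G (f i') := by
    intro f
    by_cases hf : x ≤ f i'
    · have h1 : Prod.mk f ⁻¹' D = Set.univ.pi fun j : {j // ¬ j = i} => B j (f i') := by
        ext g; simp [D, hf]
      rw [h1, Measure.pi_pi]
      simp only [G, Set.indicator_of_mem (Set.mem_Ici.2 hf)]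
      calc ∏ j : {j // ¬ j = i}, stdExp (B j (f i'))
          ≤ ∏ j : {j // ¬ j = i}, ENNReal.ofReal (C j * Real.exp (-(a j * f i'))) :=
            Finset.prod_le_prod' fun j _ => hB j j.2 _ (hx.trans hf)
        _ = _ := by
            rw [← ENNReal.ofReal_prod_of_nonneg
              (fun j _ => mul_nonneg (hC _) (Real.exp_pos _).le), Finset.prod_mul_distrib,
              ← Real.exp_sum, hs]
            simp [Finset.sum_mul]
    · have h1 : Prod.mk f ⁻¹' D = ∅ := by
        ext g; simp [D, hf]
      simp [h1]
  refine (lintegral_mono hle).trans ?_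
  refine (MeasurePreserving.lintegral_comp (ν := stdExp)
    (g := fun f : {j // j = i} → ℝ => f i')
    (by convert measurePreserving_eval (fun _ : {j // j = i} => stdExp) i') hG).le.trans ?_
  rw [lintegral_indicator measurableSet_Ici,
    setLIntegral_stdExp measurableSet_Ici (fun t ht => hx.trans ht) (by fun_prop)]
  have : ∀ t : ℝ, ENNReal.ofReal (Real.exp (-t)) *
      ENNReal.ofReal ((∏ j : {j // ¬ j = i}, C j) * Real.exp (-((s - 1) * t)))
      = ENNReal.ofReal (∏ j : {j // ¬ j = i}, C j) * ENNReal.ofReal (Real.exp (-(s * t))) := by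
    intro t
    rw [← ENNReal.ofReal_mul (Real.exp_pos _).le, ← ENNReal.ofReal_mul hCp]
    congr 1
    rw [show -(s * t) = -t + -((s - 1) * t) by ring, Real.exp_add]
    ring
  simp_rw [this]
  rw [lintegral_const_mul _ (by fun_prop), setLIntegral_Ici_exp hs0, ← ENNReal.ofReal_mul hCp]

/-- `v` wins the race with law `p` in which competitor `w` with `p w > 0` finishes at time
`T w / p w`.  The condition is written without division, and ties are allowed. -/
def Wins {V : Type*} (p T : V → ℝ) (v : V) : Prop :=
  0 < p v ∧ ∀ w, 0 < p w → p w * T v ≤ p v * T w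

lemma exists_wins {V : Type*} [Fintype V] (p T : V → ℝ) (hp : ∀ v, 0 ≤ p v)
    (hsum : ∑ v, p v = 1) : ∃ v, Wins p T v := by
  classical
  have hne : (Finset.univ.filter fun v => 0 < p v).Nonempty := by
    by_contra h
    rw [Finset.not_nonempty_iff_eq_empty, Finset.filter_eq_empty_iff] at h
    have : ∑ v, p v = 0 :=
      Finset.sum_eq_zero fun v hv => le_antisymm (not_lt.1 (h hv)) (hp v)
    linarith
  obtain ⟨v, hv, hmin⟩ := Finset.exists_min_image _ (fun v => T v / p v) hne
  simp only [Finset.mem_filter, Finset.mem_univ, true_and] at hv hmin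
  refine ⟨v, hv, fun w hw => ?_⟩
  have := hmin w hw
  rw [div_le_div_iff₀ hv hw] at this
  linarith

/-- The law of a random codebook: independent standard exponential variables indexed by `ι`. -/
noncomputable abbrev codebook (ι : Type*) [Fintype ι] : Measure (ι → ℝ) :=
  Measure.pi fun _ => stdExp

lemma codebook_le_nonneg_inter {ι : Type*} [Fintype ι] (E : Set (ι → ℝ)) :
    codebook ι E ≤ codebook ι ({T | ∀ j, 0 ≤ T j} ∩ E) := by
  have hpos : ∀ᵐ t ∂stdExp, 0 ≤ t := by
    have h : stdExp = volume.withDensity (exponentialPDF 1) := rfl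
    rw [ae_iff, show {t : ℝ | ¬ 0 ≤ t} = Set.Iio 0 by ext; simp, h,
      withDensity_apply _ measurableSet_Iio]
    exact lintegral_exponentialPDF_of_nonpos le_rfl
  have hall : ∀ᵐ T ∂(codebook ι), ∀ j, 0 ≤ T j :=
    ae_all_iff.2 fun j =>
      (measurePreserving_eval (fun _ : ι => stdExp) j).quasiMeasurePreserving.ae hpos
  refine measure_mono_ae ?_
  filter_upwards [hall] with T hT hE
  exact ⟨hT, hE⟩

section Race

variable {V : Type*} [Fintype V] {M : ℕ} {p : V → ℝ}

/-- When `v` wins with message `k`, the competitors with the same message satisfy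
`T (w, k) ≥ (p w / p v) T (v, k)`, while the variables of other messages are unconstrained by the
race.  The ratios `p w / p v` sum to `1 / p v`, which gives the factor `p v * exp (-(x / p v))`; the
additional constraints `T j ∈ B j` cost at most a factor `C j` each. -/
lemma codebook_wins_inter_le [DecidableEq V] (hp : ∀ v, 0 ≤ p v) (hsum : ∑ v, p v = 1)
    {v : V} (hv : 0 < p v) (k : Fin M) {x : ℝ} (hx : 0 ≤ x) (C : V × Fin M → ℝ) (hC : ∀ j, 0 ≤ C j)
    (B : V × Fin M → Set ℝ) (hBm : ∀ j, MeasurableSet (B j))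
    (hB : ∀ j, ∀ t, 0 ≤ t →
      stdExp (Set.Ici t ∩ B j) ≤ ENNReal.ofReal (C j * Real.exp (-t))) :
    codebook (V × Fin M)
        {T | Wins p (fun w => T (w, k)) v ∧ x ≤ T (v, k) ∧ ∀ j, j ≠ (v, k) → T j ∈ B j}
      ≤ ENNReal.ofReal ((∏ j : {j // ¬ j = (v, k)}, C j) * (p v * Real.exp (-(x / p v)))) := by
  set a : V × Fin M → ℝ := fun j => if j.2 = k then p j.1 / p v else 0 with hadef
  have ha : ∀ j, 0 ≤ a j := fun j => by
    simp only [hadef]; split_ifs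
    exacts [div_nonneg (hp _) hv.le, le_rfl]
  have hsuma : 1 + ∑ j : {j // ¬ j = (v, k)}, a j = (p v)⁻¹ := by
    have h1 := Fintype.sum_eq_add_sum_subtype_ne a (v, k)
    have h2 : a (v, k) = 1 := by simp [hadef, hv.ne']
    rw [h2] at h1
    rw [← h1, Fintype.sum_prod_type]
    simp [hadef, ← Finset.sum_div, hsum]
  have key := measure_le_of_slices (v, k) x hx (fun j t => Set.Ici (a j * t) ∩ B j) C a hC ha
    (fun j => by
      refine MeasurableSet.inter (s₁ := {p : ℝ × ℝ | a j * p.1 ≤ p.2}) ?_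
        (measurable_snd (hBm j))
      exact measurableSet_le (by fun_prop) (by fun_prop))
    (fun j _ t ht => hB j _ (mul_nonneg (ha j) ht))
  rw [hsuma] at key
  refine (codebook_le_nonneg_inter _).trans ((measure_mono ?_).trans (key.trans (le_of_eq ?_)))
  · rintro T ⟨hT0, ⟨_, hwin⟩, hxT, hTB⟩
    refine ⟨hxT, fun j hj => ⟨?_, hTB j hj⟩⟩
    obtain ⟨w, k'⟩ := j
    simp only [hadef, Set.mem_Ici]
    split_ifs with hk
    · subst hk
      rcases (hp w).eq_or_lt with h0 | h0
      · simpa [← h0] using hT0 _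
      · rw [div_mul_eq_mul_div, div_le_iff₀ hv]
        linarith [hwin w h0]
    · simpa using hT0 _
  · congr 2
    rw [div_inv_eq_mul, mul_comm, div_eq_inv_mul]

/-- The winner has law `p`, and given that `v` wins its variable is exponential with rate
`1 / p v`. -/
lemma codebook_wins_ge_le (hp : ∀ v, 0 ≤ p v) (hsum : ∑ v, p v = 1) (v : V) (k : Fin M)
    {x : ℝ} (hx : 0 ≤ x) :
    (codebook (V × Fin M)).real {T | Wins p (fun w => T (w, k)) v ∧ x ≤ T (v, k)}
      ≤ p v * Real.exp (-(x / p v)) := by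
  rcases (hp v).eq_or_lt with h0 | hv
  · simp [Wins, ← h0]
  classical
  have h := codebook_wins_inter_le hp hsum hv k hx (fun _ => 1) (fun _ => zero_le_one)
    (fun _ => Set.univ) (fun _ => MeasurableSet.univ)
    (fun j t ht => by simpa using stdExp_Ici_le ht)
  simp only [Set.mem_univ, implies_true, and_true, Finset.prod_const_one, one_mul] at h
  exact ENNReal.toReal_le_of_le_ofReal (mul_nonneg hv.le (Real.exp_pos _).le) h

lemma codebook_wins_le (hp : ∀ v, 0 ≤ p v) (hsum : ∑ v, p v = 1) (v : V) (k : Fin M) :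
    (codebook (V × Fin M)).real {T | Wins p (fun w => T (w, k)) v} ≤ p v := by
  have h := codebook_wins_ge_le hp hsum v k le_rfl
  simp only [zero_div, neg_zero, Real.exp_zero, mul_one] at h
  refine (ENNReal.toReal_mono (measure_ne_top _ _)
    ((codebook_le_nonneg_inter _).trans (measure_mono ?_))).trans h
  rintro T ⟨h0, hw⟩
  exact ⟨hw, h0 _⟩

/-- Winning only biases the variables of the losers upwards, so a loser is below the threshold `y`
with conditional probability at most `y`. -/
lemma codebook_wins_other_le (hp : ∀ v, 0 ≤ p v) (hsum : ∑ v, p v = 1) (v : V) (k : Fin M)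
    {c : V × Fin M} (hc : c ≠ (v, k)) {y : ℝ} (hy : 0 ≤ y) :
    (codebook (V × Fin M)).real {T | Wins p (fun w => T (w, k)) v ∧ T c ≤ y} ≤ p v * y := by
  classical
  rcases (hp v).eq_or_lt with h0 | hv
  · simp [Wins, ← h0]
  have h := codebook_wins_inter_le hp hsum hv k le_rfl (fun j => if j = c then y else 1)
    (fun j => by split_ifs <;> positivity)
    (fun j => if j = c then Set.Iic y else Set.univ)
    (fun j => by split_ifs <;> measurability)
    (fun j t ht => by
      split_ifs
      · simpa [Set.Ici_inter_Iic] using stdExp_Icc_le ht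
      · simpa using stdExp_Ici_le ht)
  rw [Fintype.prod_eq_single ⟨c, hc⟩
    (fun j hj => if_neg fun h => hj (Subtype.ext h))] at h
  simp only [if_true, zero_div, neg_zero, Real.exp_zero, mul_one] at h
  rw [mul_comm]
  refine ENNReal.toReal_le_of_le_ofReal (mul_nonneg hy hv.le)
    (((codebook_le_nonneg_inter _).trans (measure_mono ?_)).trans h)
  rintro T ⟨h0, hw, hcT⟩
  refine ⟨hw, h0 _, fun j _ => ?_⟩
  split_ifs with hjc
  · exact hjc ▸ hcT
  · trivial

end Race

end ExpRace

/-! ### Derandomization -/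

section Derandomization

/-- Some point of a probability space does no worse than the average of a nonnegative
combination of indicators.  The sets need not be measurable. -/
lemma exists_sum_indicator_le {Ω ι : Type*} [MeasurableSpace Ω] [Fintype ι] (μ : Measure Ω)
    [IsProbabilityMeasure μ] (w : ι → ℝ) (hw : ∀ i, 0 ≤ w i) (D : ι → Set Ω) :
    ∃ x, ∑ i, w i * (D i).indicator 1 x ≤ ∑ i, w i * μ.real (D i) := by
  -- measurable hulls have the same measure, and larger indicators
  have hint : ∀ i ∈ Finset.univ, Integrable
      (fun x => w i * (toMeasurable μ (D i)).indicator (1 : Ω → ℝ) x) μ := fun i _ =>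
    ((integrable_const (1 : ℝ)).indicator (measurableSet_toMeasurable _ _)).const_mul _
  obtain ⟨x, hx⟩ := exists_le_integral (integrable_finsetSum _ hint)
  refine ⟨x, ?_⟩
  rw [integral_finsetSum _ hint] at hx
  simp_rw [integral_const_mul, integral_indicator_one (measurableSet_toMeasurable _ _),
    measureReal_def, measure_toMeasurable, ← measureReal_def] at hx
  refine le_trans (Finset.sum_le_sum fun i _ => mul_le_mul_of_nonneg_left ?_ (hw i)) hx
  exact Set.indicator_le_indicator_of_subset (subset_toMeasurable _ _)
    (fun _ => zero_le_one) x

/-- Random symbols drawn from `K i` can be replaced by deterministic ones without increasing the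
cost. -/
lemma exists_map_sum_le {I X : Type*} [Fintype I] [Fintype X] (K : I → stdSimplex ℝ X)
    (F : I → X → ℝ) : ∃ g : I → X, ∑ i, F i (g i) ≤ ∑ i, ∑ x, K i x * F i x := by
  have h : ∀ i, ∃ x, F i x ≤ ∑ x, K i x * F i x := by
    intro i
    by_contra! hcon
    set A := ∑ x, K i x * F i x with hA
    have h1 : ∑ x, K i x * (F i x - A) = 0 := by
      simp [mul_sub, Finset.sum_sub_distrib, ← Finset.sum_mul, stdSimplex.sum_eq_one, ← hA]
    have h2 := (Finset.sum_eq_zero_iff_of_nonneg fun x _ =>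
      mul_nonneg ((K i).2.1 x) (sub_nonneg.2 (hcon x).le)).1 h1
    have h3 : ∑ x, K i x = 0 := Finset.sum_eq_zero fun x hx =>
      (mul_eq_zero.1 (h2 x hx)).resolve_right (sub_pos.2 (hcon x)).ne'
    simp [stdSimplex.sum_eq_one] at h3
  choose g hg using h
  exact ⟨g, Finset.sum_le_sum fun i _ => hg i⟩

/-- Two encoders that share the side information `s` but not their messages can be derandomized
one after the other. -/
lemma exists_encoders_sum_le {I₁ I₂ A X₁ X₂ : Type*} [Fintype I₁] [Fintype I₂] [Fintype A]
    [Fintype X₁] [Fintype X₂] (K₁ : I₁ → A → stdSimplex ℝ X₁) (K₂ : I₂ → A → stdSimplex ℝ X₂)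
    (H : I₁ → I₂ → A → X₁ → X₂ → ℝ) :
    ∃ (e₁ : I₁ → A → X₁) (e₂ : I₂ → A → X₂),
      ∑ i, ∑ j, ∑ s, H i j s (e₁ i s) (e₂ j s) ≤
        ∑ i, ∑ j, ∑ s, ∑ x₁, ∑ x₂, K₁ i s x₁ * (K₂ j s x₂ * H i j s x₁ x₂) := by
  obtain ⟨g₁, hg₁⟩ := exists_map_sum_le (fun p : I₁ × A => K₁ p.1 p.2)
    (fun p x₁ => ∑ j, ∑ x₂, K₂ j p.2 x₂ * H p.1 j p.2 x₁ x₂)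
  obtain ⟨g₂, hg₂⟩ := exists_map_sum_le (fun p : I₂ × A => K₂ p.1 p.2)
    (fun p x₂ => ∑ i, H i p.1 p.2 (g₁ (i, p.2)) x₂)
  refine ⟨fun i s => g₁ (i, s), fun j s => g₂ (j, s), ?_⟩
  simp only [Fintype.sum_prod_type, Finset.mul_sum] at hg₁ hg₂
  have e1 : ∑ i, ∑ j, ∑ s, H i j s (g₁ (i, s)) (g₂ (j, s))
      = ∑ j, ∑ s, ∑ i, H i j s (g₁ (i, s)) (g₂ (j, s)) := by
    rw [Finset.sum_comm]
    exact Finset.sum_congr rfl fun j _ => Finset.sum_comm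
  have e2 : ∑ j, ∑ s, ∑ x₂, ∑ i, K₂ j s x₂ * H i j s (g₁ (i, s)) x₂
      = ∑ i, ∑ s, ∑ j, ∑ x₂, K₂ j s x₂ * H i j s (g₁ (i, s)) x₂ := by
    calc _ = ∑ j, ∑ i, ∑ s, ∑ x₂, K₂ j s x₂ * H i j s (g₁ (i, s)) x₂ :=
          Finset.sum_congr rfl fun j _ =>
            (Finset.sum_congr rfl fun s _ => Finset.sum_comm).trans Finset.sum_comm
      _ = ∑ i, ∑ j, ∑ s, ∑ x₂, K₂ j s x₂ * H i j s (g₁ (i, s)) x₂ := Finset.sum_comm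
      _ = _ := Finset.sum_congr rfl fun i _ => Finset.sum_comm
  have e3 : ∑ i, ∑ s, ∑ x₁, ∑ j, ∑ x₂, K₁ i s x₁ * (K₂ j s x₂ * H i j s x₁ x₂)
      = ∑ i, ∑ j, ∑ s, ∑ x₁, ∑ x₂, K₁ i s x₁ * (K₂ j s x₂ * H i j s x₁ x₂) := by
    refine Finset.sum_congr rfl fun i _ => ?_
    conv_rhs => rw [Finset.sum_comm]
    exact Finset.sum_congr rfl fun s _ => Finset.sum_comm
  rw [e1, ← e3]
  exact hg₂.trans (e2.le.trans hg₁)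

/-- A decoder that outputs a message satisfying `Acc` whenever it is the only one. -/
lemma exists_decoder {Y : Type*} {M : ℕ} (hM : 0 < M) (Acc : Y → Fin M → Prop) :
    ∃ d : Y → Fin M, ∀ y m, Acc y m → (∀ m', m' ≠ m → ¬ Acc y m') → d y = m := by
  classical
  refine ⟨fun y => if h : ∃ m, Acc y m then h.choose else ⟨0, hM⟩, fun y m hm huniq => ?_⟩
  have h : ∃ m, Acc y m := ⟨m, hm⟩
  simp only [h, dif_pos]
  by_contra hne
  exact huniq _ hne h.choose_spec

end Derandomization

/-! ### One-shot coding -/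

section OneShot

open ExpRace

lemma sum_erase_product_le {I : Type*} {M : ℕ} [Fintype I] (m : Fin M) (f : I → ℝ) {β : ℝ}
    (hf : ∑ i, f i ≤ β) :
    ∑ p ∈ (Finset.univ.erase m) ×ˢ (Finset.univ : Finset I), f p.2 ≤ ((M : ℝ) - 1) * β := by
  have hM : 1 ≤ M := m.pos
  rw [Finset.sum_product]
  simp only [Finset.sum_const, Finset.card_erase_of_mem (Finset.mem_univ m), Finset.card_univ,
    Fintype.card_fin, nsmul_eq_mul]
  rw [Nat.cast_sub hM, Nat.cast_one]
  exact mul_le_mul_of_nonneg_left hf (sub_nonneg.2 (by exact_mod_cast hM))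

/-- The union bound behind the one-shot coding theorem: if the codewords `v` and `u` win the races
for the messages `k` and `m`, threshold decoding fails only if a transmitted codeword misses its
threshold, or if a codeword of a wrong message passes its threshold.  At the first decoder the
index `(w, l)` of the interfering codeword may itself be right or wrong. -/
lemma codebook_error_le {U V : Type*} [Fintype U] [Fintype V] {M₁ M₂ : ℕ}
    {p : V → ℝ} (hp : ∀ v, 0 ≤ p v) (hps : ∑ v, p v = 1)
    {r : U → ℝ} (hr : ∀ u, 0 ≤ r u) (hrs : ∑ u, r u = 1)
    {a c : V → ℝ} {b : U → V → ℝ} (ha : ∀ v, 0 ≤ a v) (hb : ∀ u v, 0 ≤ b u v)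
    (hc : ∀ v, 0 ≤ c v) {α β γ : ℝ} (hα : ∑ v, a v ≤ α) (hβ : ∀ v, ∑ u, b u v ≤ β)
    (hγ : ∑ v, c v ≤ γ) (hβ0 : 0 ≤ β)
    (u : U) (m : Fin M₁) (v : V) (k : Fin M₂)
    (D : Set ((V × Fin M₂ → ℝ) × (U × Fin M₁ → ℝ)))
    (hD : ∀ T ∈ D, Wins p (fun w => T.1 (w, k)) v ∧ Wins r (fun w => T.2 (w, m)) u ∧
      (a v ≤ T.1 (v, k) ∨ b u v ≤ T.2 (u, m) ∨ c v ≤ T.1 (v, k) ∨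
        (∃ m', m' ≠ m ∧ ∃ u' w l, T.1 (w, l) ≤ a w ∧ T.2 (u', m') ≤ b u' w) ∨
        (∃ k', k' ≠ k ∧ ∃ w, T.1 (w, k') ≤ c w))) :
    ((codebook (V × Fin M₂)).prod (codebook (U × Fin M₁))).real D ≤
      p v * r u * (Real.exp (-(a v / p v)) + Real.exp (-(b u v / r u)) + Real.exp (-(c v / p v))
        + (((M₁ : ℝ) - 1) * β * (1 + M₂ * α) + ((M₂ : ℝ) - 1) * γ)) := by
  classical
  set μ := (codebook (V × Fin M₂)).prod (codebook (U × Fin M₁)) with hμ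
  have hM₁ : (0 : ℝ) ≤ (M₁ : ℝ) - 1 := sub_nonneg.2 (by exact_mod_cast m.pos)
  set WV : Set (V × Fin M₂ → ℝ) := {T | Wins p (fun w => T (w, k)) v} with hWV
  set WU : Set (U × Fin M₁ → ℝ) := {T | Wins r (fun w => T (w, m)) u} with hWU
  have hV : (codebook (V × Fin M₂)).real WV ≤ p v := codebook_wins_le hp hps v k
  have hU : (codebook (U × Fin M₁)).real WU ≤ r u := codebook_wins_le hr hrs u m
  set E₁ := {T : V × Fin M₂ → ℝ | Wins p (fun w => T (w, k)) v ∧ a v ≤ T (v, k)} ×ˢ WU with hE₁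
  set E₂ := WV ×ˢ {T : U × Fin M₁ → ℝ | Wins r (fun w => T (w, m)) u ∧ b u v ≤ T (u, m)} with hE₂
  set E₃ := {T : V × Fin M₂ → ℝ | Wins p (fun w => T (w, k)) v ∧ c v ≤ T (v, k)} ×ˢ WU with hE₃
  set E₄ := ⋃ j ∈ (Finset.univ.erase m) ×ˢ (Finset.univ : Finset U),
    WV ×ˢ {T : U × Fin M₁ → ℝ | Wins r (fun w => T (w, m)) u ∧ T (j.2, j.1) ≤ b j.2 v} with hE₄
  set E₅ := ⋃ i ∈ Finset.univ.erase (v, k),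
    ⋃ j ∈ (Finset.univ.erase m) ×ˢ (Finset.univ : Finset U),
      {T : V × Fin M₂ → ℝ | Wins p (fun w => T (w, k)) v ∧ T i ≤ a i.1} ×ˢ
        {T : U × Fin M₁ → ℝ | Wins r (fun w => T (w, m)) u ∧ T (j.2, j.1) ≤ b j.2 i.1} with hE₅
  set E₆ := ⋃ j ∈ (Finset.univ.erase k) ×ˢ (Finset.univ : Finset V),
    {T : V × Fin M₂ → ℝ | Wins p (fun w => T (w, k)) v ∧ T (j.2, j.1) ≤ c j.2} ×ˢ WU with hE₆
  have hsub : D ⊆ E₁ ∪ E₂ ∪ E₃ ∪ E₄ ∪ E₅ ∪ E₆ := by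
    intro T hT
    obtain ⟨h1, h2, h3⟩ := hD T hT
    simp only [Set.mem_union]
    rcases h3 with h | h | h | ⟨m', hm', u', w, l, h, h'⟩ | ⟨k', hk', w, h⟩
    · exact Or.inl (Or.inl (Or.inl (Or.inl (Or.inl ⟨⟨h1, h⟩, h2⟩))))
    · exact Or.inl (Or.inl (Or.inl (Or.inl (Or.inr ⟨h1, ⟨h2, h⟩⟩))))
    · exact Or.inl (Or.inl (Or.inl (Or.inr ⟨⟨h1, h⟩, h2⟩)))
    -- only a wrong pair `(w, l)` costs a second factor `M₂ * α`
    · by_cases hwl : (w, l) = (v, k)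
      · refine Or.inl (Or.inl (Or.inr ?_))
        obtain ⟨rfl, rfl⟩ := Prod.mk.inj hwl
        exact Set.mem_biUnion (x := (m', u')) (by simpa using hm') ⟨h1, h2, h'⟩
      · refine Or.inl (Or.inr ?_)
        exact Set.mem_biUnion (x := (w, l)) (by simpa using hwl)
          (Set.mem_biUnion (x := (m', u')) (by simpa using hm') ⟨⟨h1, h⟩, h2, h'⟩)
    · exact Or.inr (Set.mem_biUnion (x := (k', w)) (by simpa using hk') ⟨⟨h1, h⟩, h2⟩)
  have b₁ : μ.real E₁ ≤ p v * Real.exp (-(a v / p v)) * r u := by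
    rw [hμ, hE₁, measureReal_prod_prod]
    exact mul_le_mul (codebook_wins_ge_le hp hps v k (ha v)) hU measureReal_nonneg
      (mul_nonneg (hp v) (Real.exp_pos _).le)
  have b₂ : μ.real E₂ ≤ p v * (r u * Real.exp (-(b u v / r u))) := by
    rw [hμ, hE₂, measureReal_prod_prod]
    exact mul_le_mul hV (codebook_wins_ge_le hr hrs u m (hb u v)) measureReal_nonneg (hp v)
  have b₃ : μ.real E₃ ≤ p v * Real.exp (-(c v / p v)) * r u := by
    rw [hμ, hE₃, measureReal_prod_prod]
    exact mul_le_mul (codebook_wins_ge_le hp hps v k (hc v)) hU measureReal_nonneg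
      (mul_nonneg (hp v) (Real.exp_pos _).le)
  have b₄ : μ.real E₄ ≤ p v * (r u * (((M₁ : ℝ) - 1) * β)) := by
    calc μ.real E₄ ≤ ∑ j ∈ (Finset.univ.erase m) ×ˢ (Finset.univ : Finset U),
          p v * (r u * b j.2 v) := by
          refine (measureReal_biUnion_finset_le _ _).trans (Finset.sum_le_sum fun j hj => ?_)
          rw [hμ, measureReal_prod_prod]
          refine mul_le_mul hV (codebook_wins_other_le hr hrs u m ?_ (hb _ _))
            measureReal_nonneg (hp v)
          simp only [Finset.mem_product, Finset.mem_erase] at hj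
          exact fun h => hj.1.1 (Prod.mk.inj h).2
      _ = p v * (r u * ∑ j ∈ (Finset.univ.erase m) ×ˢ (Finset.univ : Finset U), b j.2 v) := by
          rw [Finset.mul_sum, Finset.mul_sum]
      _ ≤ _ := mul_le_mul_of_nonneg_left (mul_le_mul_of_nonneg_left
          (sum_erase_product_le m (fun u => b u v) (hβ v)) (hr u)) (hp v)
  have b₅ : μ.real E₅ ≤ p v * (r u * (((M₁ : ℝ) - 1) * β)) * (M₂ * α) := by
    calc μ.real E₅ ≤ ∑ i ∈ Finset.univ.erase (v, k),
          p v * (r u * (((M₁ : ℝ) - 1) * β)) * a i.1 := by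
          refine (measureReal_biUnion_finset_le _ _).trans (Finset.sum_le_sum fun i hi => ?_)
          calc _ ≤ ∑ j ∈ (Finset.univ.erase m) ×ˢ (Finset.univ : Finset U),
                (p v * a i.1) * (r u * b j.2 i.1) := by
                refine (measureReal_biUnion_finset_le _ _).trans
                  (Finset.sum_le_sum fun j hj => ?_)
                rw [hμ, measureReal_prod_prod]
                refine mul_le_mul (codebook_wins_other_le hp hps v k (Finset.ne_of_mem_erase hi)
                  (ha _)) (codebook_wins_other_le hr hrs u m ?_ (hb _ _))
                  measureReal_nonneg (mul_nonneg (hp v) (ha _))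
                simp only [Finset.mem_product, Finset.mem_erase] at hj
                exact fun h => hj.1.1 (Prod.mk.inj h).2
            _ = (p v * a i.1) * (r u *
                  ∑ j ∈ (Finset.univ.erase m) ×ˢ (Finset.univ : Finset U), b j.2 i.1) := by
                rw [Finset.mul_sum, Finset.mul_sum]
            _ ≤ (p v * a i.1) * (r u * (((M₁ : ℝ) - 1) * β)) :=
                mul_le_mul_of_nonneg_left (mul_le_mul_of_nonneg_left
                  (sum_erase_product_le m (fun u => b u i.1) (hβ i.1)) (hr u))
                  (mul_nonneg (hp v) (ha _))
            _ = _ := by ring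
      _ ≤ ∑ i : V × Fin M₂, p v * (r u * (((M₁ : ℝ) - 1) * β)) * a i.1 :=
          Finset.sum_le_sum_of_subset_of_nonneg (Finset.subset_univ _) fun i _ _ =>
            mul_nonneg (mul_nonneg (hp v) (mul_nonneg (hr u) (mul_nonneg hM₁ hβ0))) (ha _)
      _ = p v * (r u * (((M₁ : ℝ) - 1) * β)) * (M₂ * ∑ w, a w) := by
          rw [← Finset.mul_sum, Fintype.sum_prod_type]
          simp [Finset.mul_sum]
      _ ≤ _ := by
          refine mul_le_mul_of_nonneg_left (mul_le_mul_of_nonneg_left hα (Nat.cast_nonneg _)) ?_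
          exact mul_nonneg (hp v) (mul_nonneg (hr u) (mul_nonneg hM₁ hβ0))
  have b₆ : μ.real E₆ ≤ p v * (((M₂ : ℝ) - 1) * γ) * r u := by
    calc μ.real E₆ ≤ ∑ j ∈ (Finset.univ.erase k) ×ˢ (Finset.univ : Finset V),
          p v * c j.2 * r u := by
          refine (measureReal_biUnion_finset_le _ _).trans (Finset.sum_le_sum fun j hj => ?_)
          rw [hμ, measureReal_prod_prod]
          refine mul_le_mul (codebook_wins_other_le hp hps v k ?_ (hc _)) hU
            measureReal_nonneg (mul_nonneg (hp v) (hc _))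
          simp only [Finset.mem_product, Finset.mem_erase] at hj
          exact fun h => hj.1.1 (Prod.mk.inj h).2
      _ = p v * (∑ j ∈ (Finset.univ.erase k) ×ˢ (Finset.univ : Finset V), c j.2) * r u := by
          rw [Finset.mul_sum, Finset.sum_mul]
      _ ≤ _ := mul_le_mul_of_nonneg_right (mul_le_mul_of_nonneg_left
          (sum_erase_product_le k c hγ) (hp v)) (hr u)
  have hall : μ.real D ≤ μ.real E₁ + μ.real E₂ + μ.real E₃ + μ.real E₄ + μ.real E₅
      + μ.real E₆ := by
    refine (measureReal_mono hsub).trans ?_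
    refine (measureReal_union_le _ _).trans (add_le_add_left ?_ _)
    refine (measureReal_union_le _ _).trans (add_le_add_left ?_ _)
    refine (measureReal_union_le _ _).trans (add_le_add_left ?_ _)
    refine (measureReal_union_le _ _).trans (add_le_add_left ?_ _)
    exact measureReal_union_le _ _
  calc μ.real D ≤ _ := hall
    _ ≤ _ := add_le_add (add_le_add (add_le_add (add_le_add (add_le_add b₁ b₂) b₃) b₄) b₅) b₆
    _ = _ := by ring

end OneShot

section OneShotCode

open ExpRace

variable {S₁ S₂ X₁ X₂ Y₁ Y₂ U V : Type*} [Fintype S₁] [Fintype S₂] [Fintype X₁] [Fintype X₂]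
  [Fintype Y₁] [Fintype Y₂] [Fintype U] [Fintype V]

/-- The conditional probability, up to a union bound, that a transmitted codeword exceeds its
decoding threshold (`a` for `v` and `b` for `u` at the first decoder, `c` for `v` at the second):
the race makes the winning variables exponential with means `P(v|s₂)` and `P(u|s₁,s₂)`. -/
noncomputable def ZICInput.missProb (q : ZICInput S₁ S₂ X₁ X₂ U V) (a : V → Y₁ → ℝ)
    (b : U → V → Y₁ → ℝ) (c : V → Y₂ → ℝ) : S₁ × S₂ × U × X₁ × V × X₂ × Y₁ × Y₂ → ℝ :=
  fun (s₁, s₂, u, _, v, _, y₁, y₂) =>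
    Real.exp (-(a v y₁ / q.pV s₂ v)) + Real.exp (-(b u v y₁ / q.pU s₁ s₂ u)) +
      Real.exp (-(c v y₂ / q.pV s₂ v))

/-- Coding for a single use of the channel.  The thresholds `a`, `b`, `c` are free; `α`, `β`, `γ`
bound their total masses, hence the expected numbers of codewords of one message that pass.  The
factors `M₁ - 1` and `M₂ - 1` count the wrong messages and vanish for a single message. -/
theorem exists_oneShot_code (ch : StateZIC S₁ S₂ X₁ X₂ Y₁ Y₂) (q : ZICInput S₁ S₂ X₁ X₂ U V)
    {M₁ M₂ : ℕ} (hM₁ : 0 < M₁) (hM₂ : 0 < M₂)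
    {a : V → Y₁ → ℝ} {b : U → V → Y₁ → ℝ} {c : V → Y₂ → ℝ}
    (ha : ∀ v y, 0 ≤ a v y) (hb : ∀ u v y, 0 ≤ b u v y) (hc : ∀ v y, 0 ≤ c v y)
    {α β γ : ℝ} (hα : ∀ y, ∑ v, a v y ≤ α) (hβ : ∀ v y, ∑ u, b u v y ≤ β)
    (hγ : ∀ y, ∑ v, c v y ≤ γ) (hβ0 : 0 ≤ β) :
    ∃ (e₁ : Fin M₁ → S₁ → S₂ → X₁) (e₂ : Fin M₂ → S₁ → S₂ → X₂)
      (d₁ : Y₁ → Fin M₁) (d₂ : Y₂ → Fin M₂),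
      1 / ((M₁ : ℝ) * (M₂ : ℝ)) * ∑ m, ∑ k, ∑ s₁, ∑ s₂, ch.state (s₁, s₂) *
        ∑ y₁, ∑ y₂, ch.chan₁ s₁ (e₁ m s₁ s₂) (e₂ k s₁ s₂) y₁ * ch.chan₂ s₂ (e₂ k s₁ s₂) y₂ *
          (if (d₁ y₁, d₂ y₂) ≠ (m, k) then 1 else 0) ≤
      ∑ ω, q.joint ch ω * q.missProb a b c ω +
      (((M₁ : ℝ) - 1) * β * (1 + M₂ * α) + ((M₂ : ℝ) - 1) * γ) := by
  classical
  have hpick₂ : ∀ (T : V × Fin M₂ → ℝ) (k : Fin M₂) (s₂ : S₂),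
      ∃ v, Wins (q.pV s₂) (fun w => T (w, k)) v := fun T k s₂ =>
    exists_wins _ _ (q.pV s₂).2.1 (stdSimplex.sum_eq_one _)
  have hpick₁ : ∀ (T : U × Fin M₁ → ℝ) (m : Fin M₁) (s : S₁ × S₂),
      ∃ u, Wins (q.pU s.1 s.2) (fun w => T (w, m)) u := fun T k s =>
    exists_wins _ _ (q.pU s.1 s.2).2.1 (stdSimplex.sum_eq_one _)
  choose pick₂ hpick₂ using hpick₂
  choose pick₁ hpick₁ using hpick₁
  obtain ⟨d₁, hd₁⟩ := exists_decoder hM₁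
    (fun (z : ((V × Fin M₂ → ℝ) × (U × Fin M₁ → ℝ)) × Y₁) m =>
      ∃ u w l, z.1.1 (w, l) ≤ a w z.2 ∧ z.1.2 (u, m) ≤ b u w z.2)
  obtain ⟨d₂, hd₂⟩ := exists_decoder hM₂
    (fun (z : ((V × Fin M₂ → ℝ) × (U × Fin M₁ → ℝ)) × Y₂) k => ∃ w, z.1.1 (w, k) ≤ c w z.2)
  set R := (((M₁ : ℝ) - 1) * β * (1 + M₂ * α) + ((M₂ : ℝ) - 1) * γ) with hR
  -- the weights omit the laws of `u` and `v`, which are produced by the two races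
  let w : Fin M₁ × Fin M₂ × S₁ × S₂ × U × X₁ × V × X₂ × Y₁ × Y₂ → ℝ :=
    fun (_, _, s₁, s₂, u, x₁, v, x₂, y₁, y₂) =>
      ch.state (s₁, s₂) * (q.pX₁ u s₁ s₂ x₁ * (q.pX₂ v s₂ x₂ *
        (ch.chan₁ s₁ x₁ x₂ y₁ * ch.chan₂ s₂ x₂ y₂)))
  let D : Fin M₁ × Fin M₂ × S₁ × S₂ × U × X₁ × V × X₂ × Y₁ × Y₂ →
      Set ((V × Fin M₂ → ℝ) × (U × Fin M₁ → ℝ)) :=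
    fun (m, k, s₁, s₂, u, _, v, _, y₁, y₂) =>
      {T | pick₂ T.1 k s₂ = v ∧ pick₁ T.2 m (s₁, s₂) = u ∧ (d₁ (T, y₁), d₂ (T, y₂)) ≠ (m, k)}
  have hw : ∀ i, 0 ≤ w i := by
    rintro ⟨m, k, s₁, s₂, u, x₁, v, x₂, y₁, y₂⟩
    exact mul_nonneg (ch.state.2.1 _) (mul_nonneg ((q.pX₁ _ _ _).2.1 _)
      (mul_nonneg ((q.pX₂ _ _).2.1 _)
        (mul_nonneg ((ch.chan₁ _ _ _).2.1 _) ((ch.chan₂ _ _).2.1 _))))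
  obtain ⟨T, hT⟩ := exists_sum_indicator_le
    ((codebook (V × Fin M₂)).prod (codebook (U × Fin M₁))) w hw D
  obtain ⟨e₁, e₂, he⟩ := exists_encoders_sum_le
    (fun m (s : S₁ × S₂) => q.pX₁ (pick₁ T.2 m s) s.1 s.2)
    (fun k (s : S₁ × S₂) => q.pX₂ (pick₂ T.1 k s.2) s.2)
    (fun m k s x₁ x₂ => ch.state s * ∑ y₁, ∑ y₂, ch.chan₁ s.1 x₁ x₂ y₁ * ch.chan₂ s.2 x₂ y₂ *
          (if (d₁ (T, y₁), d₂ (T, y₂)) ≠ (m, k) then 1 else 0))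
  refine ⟨fun m s₁ s₂ => e₁ m (s₁, s₂), fun k s₁ s₂ => e₂ k (s₁, s₂), fun y => d₁ (T, y),
    fun y => d₂ (T, y), ?_⟩
  have hMpos : (0 : ℝ) < (M₁ : ℝ) * M₂ := by positivity
  rw [div_mul_eq_mul_div, one_mul, div_le_iff₀ hMpos]
  simp only [Fintype.sum_prod_type] at he
  refine he.trans ?_
  -- the races select a single pair `(u, v)` for each state pair
  have hcollapse : ∑ m, ∑ k, ∑ s₁, ∑ s₂, ∑ x₁, ∑ x₂, q.pX₁ (pick₁ T.2 m (s₁, s₂)) s₁ s₂ x₁ *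
      (q.pX₂ (pick₂ T.1 k s₂) s₂ x₂ * (ch.state (s₁, s₂) *
        ∑ y₁, ∑ y₂, ch.chan₁ s₁ x₁ x₂ y₁ * ch.chan₂ s₂ x₂ y₂ *
          (if (d₁ (T, y₁), d₂ (T, y₂)) ≠ (m, k) then 1 else 0)))
      = ∑ i, w i * (D i).indicator 1 T := by
    simp only [Fintype.sum_prod_type]
    refine Finset.sum_congr rfl fun m _ => Finset.sum_congr rfl fun k _ =>
      Finset.sum_congr rfl fun s₁ _ => Finset.sum_congr rfl fun s₂ _ => ?_
    rw [Fintype.sum_eq_single (pick₁ T.2 m (s₁, s₂))]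
    swap
    · intro u hu
      refine Finset.sum_eq_zero fun x₁ _ => Finset.sum_eq_zero fun v _ =>
        Finset.sum_eq_zero fun x₂ _ => Finset.sum_eq_zero fun y₁ _ =>
        Finset.sum_eq_zero fun y₂ _ => ?_
      rw [Set.indicator_of_notMem, mul_zero]
      exact fun h => hu h.2.1.symm
    refine Finset.sum_congr rfl fun x₁ _ => ?_
    rw [Fintype.sum_eq_single (pick₂ T.1 k s₂)]
    swap
    · intro v hv
      refine Finset.sum_eq_zero fun x₂ _ => Finset.sum_eq_zero fun y₁ _ =>
        Finset.sum_eq_zero fun y₂ _ => ?_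
      rw [Set.indicator_of_notMem, mul_zero]
      exact fun h => hv h.1.symm
    refine Finset.sum_congr rfl fun x₂ _ => ?_
    simp only [Finset.mul_sum]
    refine Finset.sum_congr rfl fun y₁ _ => Finset.sum_congr rfl fun y₂ _ => ?_
    have hind : (D (m, k, s₁, s₂, pick₁ T.2 m (s₁, s₂), x₁, pick₂ T.1 k s₂, x₂, y₁, y₂)).indicator
        (1 : ((V × Fin M₂ → ℝ) × (U × Fin M₁ → ℝ)) → ℝ) T =
          if (d₁ (T, y₁), d₂ (T, y₂)) ≠ (m, k) then 1 else 0 := by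
      simp [D, Set.indicator_apply]
    rw [hind]
    simp only [w]
    ring
  rw [hcollapse]
  refine hT.trans ?_
  have hterm : ∀ i, w i * ((codebook (V × Fin M₂)).prod (codebook (U × Fin M₁))).real (D i) ≤
      q.joint ch i.2.2 * (q.missProb a b c i.2.2 + R) := by
    rintro ⟨m, k, s₁, s₂, u, x₁, v, x₂, y₁, y₂⟩
    have h := codebook_error_le (p := q.pV s₂) (r := q.pU s₁ s₂) (q.pV s₂).2.1
      (stdSimplex.sum_eq_one _) (q.pU s₁ s₂).2.1
      (stdSimplex.sum_eq_one _) (fun v => ha v y₁) (fun u v => hb u v y₁) (fun v => hc v y₂)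
      (hα y₁) (fun v => hβ v y₁) (hγ y₂) hβ0 u m v k
      (D (m, k, s₁, s₂, u, x₁, v, x₂, y₁, y₂)) (by
        rintro T ⟨hv, hu, herr⟩
        refine ⟨hv ▸ hpick₂ T.1 k s₂, hu ▸ hpick₁ T.2 m (s₁, s₂), ?_⟩
        by_contra! hcon
        obtain ⟨h1, h2, h3, h4, h5⟩ := hcon
        refine herr (Prod.ext ?_ ?_)
        · refine hd₁ (T, y₁) m ⟨u, v, k, h1.le, h2.le⟩ ?_
          rintro m' hm' ⟨u', w, l, h6, h7⟩
          exact (h4 m' hm' u' w l h6).not_ge h7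
        · refine hd₂ (T, y₂) k ⟨v, h3.le⟩ ?_
          rintro k' hk' ⟨w, h6⟩
          exact (h5 k' hk' w).not_ge h6)
    refine (mul_le_mul_of_nonneg_left h
      (hw (m, k, s₁, s₂, u, x₁, v, x₂, y₁, y₂))).trans (le_of_eq ?_)
    have hJ : q.joint ch (s₁, s₂, u, x₁, v, x₂, y₁, y₂) =
        w (m, k, s₁, s₂, u, x₁, v, x₂, y₁, y₂) * (q.pV s₂ v * q.pU s₁ s₂ u) := by
      change ch.state (s₁, s₂) * (q.pU s₁ s₂ u * (q.pX₁ u s₁ s₂ x₁ * (q.pV s₂ v *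
        (q.pX₂ v s₂ x₂ * (ch.chan₁ s₁ x₁ x₂ y₁ * ch.chan₂ s₂ x₂ y₂))))) = _
      simp only [w]
      ring
    simp only [hJ, hR, ZICInput.missProb]
    ring
  refine (Finset.sum_le_sum fun i _ => hterm i).trans (le_of_eq ?_)
  have hone : ∑ ω, q.joint ch ω = 1 := stdSimplex.sum_eq_one _
  rw [Fintype.sum_prod_type]
  simp only [Fintype.sum_prod_type (α₁ := Fin M₂)]
  simp only [Finset.sum_const, Finset.card_univ, Fintype.card_fin, nsmul_eq_mul]
  simp only [mul_add (q.joint ch _) _ R, Finset.sum_add_distrib, ← Finset.sum_mul, hone]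
  ring

end OneShotCode

/-! ### Expectations of products and block channels -/

section Tail

lemma exp_neg_le_rpow {z r : ℝ} (hz : 0 < z) (hr0 : 0 ≤ r) (hr1 : r ≤ 1) :
    Real.exp (-z) ≤ z ^ (-r) := by
  rw [Real.exp_neg, Real.rpow_neg hz.le]
  refine inv_anti₀ (Real.rpow_pos_of_pos hz _) ?_
  rcases le_total z 1 with h | h
  · exact (Real.rpow_le_one hz.le h hr0).trans (Real.one_le_exp hz.le)
  · calc z ^ r ≤ z ^ (1 : ℝ) := Real.rpow_le_rpow_of_exponent_le h hr1
      _ ≤ Real.exp z := by rw [Real.rpow_one]; linarith [Real.add_one_le_exp z]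

variable {Ω : Type*} [Fintype Ω]

/-- Chernoff's argument: the moment of order `-r` has derivative `-∑ ω, P ω * log (z ω)` at
`r = 0`, where its value is one. -/
lemma exists_moment_lt_one (P : stdSimplex ℝ Ω) (z : Ω → ℝ)
    (hlog : 0 < ∑ ω, P ω * Real.log (z ω)) :
    ∃ r : ℝ, 0 < r ∧ r ≤ 1 ∧ ∑ ω, P ω * Real.exp (-r * Real.log (z ω)) < 1 := by
  set f : ℝ → ℝ := fun r => ∑ ω, P ω * Real.exp (-r * Real.log (z ω)) with hf
  have hd : HasDerivAt f (∑ ω, P ω * (Real.exp (-0 * Real.log (z ω)) *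
      (-1 * Real.log (z ω)))) 0 := by
    refine HasDerivAt.fun_sum fun ω _ => ?_
    exact (((hasDerivAt_neg (0 : ℝ)).mul_const _).exp).const_mul _
  have hval : ∑ ω, P ω * (Real.exp (-0 * Real.log (z ω)) * (-1 * Real.log (z ω))) =
      -∑ ω, P ω * Real.log (z ω) := by
    rw [← Finset.sum_neg_distrib]
    exact Finset.sum_congr rfl fun ω _ => by simp
  rw [hval, hasDerivAt_iff_tendsto_slope] at hd
  have hneg : ∀ᶠ r in 𝓝[>] (0 : ℝ), slope f 0 r < 0 :=
    (hd.mono_left (nhdsWithin_mono _ fun r hr => (Set.mem_Ioi.1 hr).ne')).eventually_lt_const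
      (neg_lt_zero.2 hlog)
  have hsmall : ∀ᶠ r in 𝓝[>] (0 : ℝ), r < 1 :=
    eventually_nhdsWithin_of_eventually_nhds (eventually_lt_nhds one_pos)
  obtain ⟨r, ⟨hs, h1⟩, h0⟩ := ((hneg.and hsmall).and self_mem_nhdsWithin).exists
  have h0 : 0 < r := h0
  refine ⟨r, h0, h1.le, ?_⟩
  have hf0 : f 0 = 1 := by simp [hf, stdSimplex.sum_eq_one]
  rw [slope_def_field, hf0, sub_zero, div_lt_iff₀ h0, zero_mul, sub_lt_zero] at hs
  exact hs

/-- If `z` has positive expected logarithm, then a product of `n` independent copies of `z` is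
large, and `exp (-∏ z)` has an exponentially small expectation. -/
lemma exists_expectation_exp_neg_prod_le (P : stdSimplex ℝ Ω) (z : Ω → ℝ)
    (hz : ∀ ω, 0 < P ω → 0 < z ω) (hlog : 0 < ∑ ω, P ω * Real.log (z ω)) :
    ∃ ρ : ℝ, 0 ≤ ρ ∧ ρ < 1 ∧ ∀ n : ℕ,
      ∑ ω : Fin n → Ω, (∏ i, P (ω i)) * Real.exp (-∏ i, z (ω i)) ≤ ρ ^ n := by
  obtain ⟨r, hr0, hr1, hr⟩ := exists_moment_lt_one P z hlog
  refine ⟨∑ ω, P ω * Real.exp (-r * Real.log (z ω)),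
    Finset.sum_nonneg fun ω _ => mul_nonneg (P.2.1 ω) (Real.exp_pos _).le, hr, fun n => ?_⟩
  rw [Fintype.sum_pow]
  refine Finset.sum_le_sum fun ω _ => ?_
  rw [Finset.prod_mul_distrib]
  by_cases h : ∀ i, 0 < P (ω i)
  · refine mul_le_mul_of_nonneg_left ?_ (Finset.prod_nonneg fun i _ => (h i).le)
    have hzp : ∀ i, 0 < z (ω i) := fun i => hz _ (h i)
    refine (exp_neg_le_rpow (Finset.prod_pos fun i _ => hzp i) hr0.le hr1).trans (le_of_eq ?_)
    rw [← Real.finsetProd_rpow _ _ fun i _ => (hzp i).le]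
    refine Finset.prod_congr rfl fun i _ => ?_
    rw [Real.rpow_def_of_pos (hzp i), mul_comm]
  · obtain ⟨i, hi⟩ := not_forall.1 h
    have h0 : ∏ i, P (ω i) = 0 :=
      Finset.prod_eq_zero (Finset.mem_univ i) (le_antisymm (not_lt.1 hi) (P.2.1 _))
    rw [h0, zero_mul, zero_mul]

end Tail

section Block

/-- The product law of independent symbols `x i` with laws `P i`. -/
noncomputable def stdSimplex.blockProd {α : Type*} [Fintype α] {n : ℕ}
    (P : Fin n → stdSimplex ℝ α) : stdSimplex ℝ (Fin n → α) :=
  ⟨fun x => ∏ i, P i (x i), fun x => Finset.prod_nonneg fun i _ => (P i).2.1 _, by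
    classical
    refine (Fintype.prod_sum fun i x => P i x).symm.trans ?_
    exact Finset.prod_eq_one fun i _ => stdSimplex.sum_eq_one _⟩

lemma sum_arrow_prod {n : ℕ} {α β : Type*} [Fintype α] [Fintype β] (F : (Fin n → α × β) → ℝ) :
    ∑ ω, F ω = ∑ a : Fin n → α, ∑ b : Fin n → β, F fun i => (a i, b i) := by
  rw [← Fintype.sum_prod_type' (f := fun (a : Fin n → α) (b : Fin n → β) => F fun i => (a i, b i))]
  exact Fintype.sum_equiv (Equiv.arrowProdEquivProdArrow _ _ _) _ _ fun ω => rfl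

variable {S₁ S₂ X₁ X₂ Y₁ Y₂ U V : Type*} [Fintype S₁] [Fintype S₂] [Fintype X₁] [Fintype X₂]
  [Fintype Y₁] [Fintype Y₂] [Fintype U] [Fintype V]

/-- `n` independent uses of a channel, as a single use of a channel with block alphabets. -/
noncomputable def StateZIC.block (ch : StateZIC S₁ S₂ X₁ X₂ Y₁ Y₂) (n : ℕ) :
    StateZIC (Fin n → S₁) (Fin n → S₂) (Fin n → X₁) (Fin n → X₂) (Fin n → Y₁) (Fin n → Y₂) where
  state := ⟨fun s => ∏ i, ch.state (s.1 i, s.2 i),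
    fun s => Finset.prod_nonneg fun i _ => ch.state.2.1 _, by
      rw [Fintype.sum_prod_type, ← sum_arrow_prod fun s => ∏ i, ch.state (s i)]
      exact stdSimplex.sum_eq_one (stdSimplex.blockProd fun _ : Fin n => ch.state)⟩
  chan₁ s x₁ x₂ := stdSimplex.blockProd fun i => ch.chan₁ (s i) (x₁ i) (x₂ i)
  chan₂ s x₂ := stdSimplex.blockProd fun i => ch.chan₂ (s i) (x₂ i)

/-- The memoryless extension of the conditional laws of the auxiliary variables and inputs. -/
noncomputable def ZICInput.block (q : ZICInput S₁ S₂ X₁ X₂ U V) (n : ℕ) :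
    ZICInput (Fin n → S₁) (Fin n → S₂) (Fin n → X₁) (Fin n → X₂) (Fin n → U) (Fin n → V) where
  pU s₁ s₂ := stdSimplex.blockProd fun i => q.pU (s₁ i) (s₂ i)
  pX₁ u s₁ s₂ := stdSimplex.blockProd fun i => q.pX₁ (u i) (s₁ i) (s₂ i)
  pV s₂ := stdSimplex.blockProd fun i => q.pV (s₂ i)
  pX₂ v s₂ := stdSimplex.blockProd fun i => q.pX₂ (v i) (s₂ i)

lemma ZICInput.joint_block (q : ZICInput S₁ S₂ X₁ X₂ U V) (ch : StateZIC S₁ S₂ X₁ X₂ Y₁ Y₂)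
    (n : ℕ) (s₁ : Fin n → S₁) (s₂ : Fin n → S₂) (u : Fin n → U) (x₁ : Fin n → X₁)
    (v : Fin n → V) (x₂ : Fin n → X₂) (y₁ : Fin n → Y₁) (y₂ : Fin n → Y₂) :
    (q.block n).joint (ch.block n) (s₁, s₂, u, x₁, v, x₂, y₁, y₂) =
      ∏ i, q.joint ch (s₁ i, s₂ i, u i, x₁ i, v i, x₂ i, y₁ i, y₂ i) := by
  change (∏ i, ch.state (s₁ i, s₂ i)) * ((∏ i, q.pU (s₁ i) (s₂ i) (u i)) *
    ((∏ i, q.pX₁ (u i) (s₁ i) (s₂ i) (x₁ i)) * ((∏ i, q.pV (s₂ i) (v i)) *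
    ((∏ i, q.pX₂ (v i) (s₂ i) (x₂ i)) * ((∏ i, ch.chan₁ (s₁ i) (x₁ i) (x₂ i) (y₁ i)) *
    (∏ i, ch.chan₂ (s₂ i) (x₂ i) (y₂ i))))))) = _
  simp only [← Finset.prod_mul_distrib]
  rfl

/-- Expectations under the block law are expectations under `n` independent copies of the
one-letter law. -/
lemma ZICInput.sum_joint_block (q : ZICInput S₁ S₂ X₁ X₂ U V) (ch : StateZIC S₁ S₂ X₁ X₂ Y₁ Y₂)
    (n : ℕ) (F : (Fin n → S₁) × (Fin n → S₂) × (Fin n → U) × (Fin n → X₁) × (Fin n → V) ×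
      (Fin n → X₂) × (Fin n → Y₁) × (Fin n → Y₂) → ℝ) :
    ∑ ω, (q.block n).joint (ch.block n) ω * F ω =
      ∑ ω : Fin n → S₁ × S₂ × U × X₁ × V × X₂ × Y₁ × Y₂, (∏ i, q.joint ch (ω i)) *
        F (fun i => (ω i).1, fun i => (ω i).2.1, fun i => (ω i).2.2.1, fun i => (ω i).2.2.2.1,
          fun i => (ω i).2.2.2.2.1, fun i => (ω i).2.2.2.2.2.1, fun i => (ω i).2.2.2.2.2.2.1,
          fun i => (ω i).2.2.2.2.2.2.2) := by
  simp only [sum_arrow_prod, Fintype.sum_prod_type, ZICInput.joint_block]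

end Block

/-! ### Mutual information and conditional laws -/

section Information

variable {Ω α β σ : Type*} [Fintype Ω]

lemma probEq_nonneg (P : stdSimplex ℝ Ω) (A : Ω → α) (a : α) : 0 ≤ probEq P A a := by
  classical
  refine Finset.sum_nonneg fun ω _ => ?_
  split_ifs
  exacts [P.2.1 ω, le_rfl]

lemma le_probEq (P : stdSimplex ℝ Ω) (A : Ω → α) (ω : Ω) : P ω ≤ probEq P A (A ω) := by
  classical
  have h : ∀ ω' ∈ Finset.univ, 0 ≤ if A ω' = A ω then P ω' else 0 := fun ω' _ => by
    split_ifs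
    exacts [P.2.1 ω', le_rfl]
  have := Finset.single_le_sum h (Finset.mem_univ ω)
  simp only [if_true] at this
  refine this.trans_eq ?_
  unfold probEq
  congr!

lemma sum_probEq_pair [Fintype α] (P : stdSimplex ℝ Ω) (A : Ω → α) (B : Ω → β) (b : β) :
    ∑ a, probEq P (fun ω => (A ω, B ω)) (a, b) = probEq P B b := by
  classical
  unfold probEq
  rw [Finset.sum_comm]
  refine Finset.sum_congr rfl fun ω _ => ?_
  simp only [Prod.mk.injEq, ite_and]
  rw [Finset.sum_ite_eq]
  simp

lemma sum_probEq_mul [Fintype α] [Fintype β] (P : stdSimplex ℝ Ω) (A : Ω → α) (B : Ω → β)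
    (g : α → β → ℝ) :
    ∑ a, ∑ b, probEq P (fun ω => (A ω, B ω)) (a, b) * g a b = ∑ ω, P ω * g (A ω) (B ω) := by
  classical
  unfold probEq
  simp only [Finset.sum_mul, ite_mul, zero_mul, Prod.mk.injEq, ite_and]
  have h : ∀ a, ∑ b, ∑ ω, (if A ω = a then if B ω = b then P ω * g a b else 0 else 0)
      = ∑ ω, if A ω = a then P ω * g a (B ω) else 0 := fun a => by
    rw [Finset.sum_comm]
    refine Finset.sum_congr rfl fun ω _ => ?_
    split_ifs <;> simp
  simp only [h]
  rw [Finset.sum_comm]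
  refine Finset.sum_congr rfl fun ω _ => ?_
  simp

lemma mutualInfo_eq_sum [Fintype α] [Fintype β] (P : stdSimplex ℝ Ω) (A : Ω → α) (B : Ω → β) :
    mutualInfo P A B = ∑ ω, P ω * Real.logb 2 (probEq P (fun ω => (A ω, B ω)) (A ω, B ω) /
      (probEq P A (A ω) * probEq P B (B ω))) :=
  sum_probEq_mul P A B fun a b => Real.logb 2 (probEq P (fun ω => (A ω, B ω)) (a, b) /
      (probEq P A a * probEq P B b))

/-- The conditional probability `P(A = a | B = b)`, with value `0` if `P(B = b) = 0`. -/
noncomputable def condProbEq (P : stdSimplex ℝ Ω) (A : Ω → α) (B : Ω → β) (a : α) (b : β) : ℝ :=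
  probEq P (fun ω => (A ω, B ω)) (a, b) / probEq P B b

lemma condProbEq_nonneg (P : stdSimplex ℝ Ω) (A : Ω → α) (B : Ω → β) (a : α) (b : β) :
    0 ≤ condProbEq P A B a b :=
  div_nonneg (probEq_nonneg _ _ _) (probEq_nonneg _ _ _)

lemma sum_condProbEq_le_one [Fintype α] (P : stdSimplex ℝ Ω) (A : Ω → α) (B : Ω → β) (b : β) :
    ∑ a, condProbEq P A B a b ≤ 1 := by
  unfold condProbEq
  rw [← Finset.sum_div, sum_probEq_pair]
  exact div_self_le_one _

lemma condProbEq_pos (P : stdSimplex ℝ Ω) (A : Ω → α) (B : Ω → β) {ω : Ω} (hω : 0 < P ω) :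
    0 < condProbEq P A B (A ω) (B ω) :=
  div_pos (hω.trans_le (le_probEq P (fun ω => (A ω, B ω)) ω)) (hω.trans_le (le_probEq P B ω))

/-- If `κ s a` is the conditional probability of `A = a` given `S = s`, the expected logarithm of
the ratio of `P(A|B)` and `κ` is a difference of mutual informations. -/
lemma sum_mul_logb_condProbEq_div [Fintype α] [Fintype β] [Fintype σ]
    (P : stdSimplex ℝ Ω) (A : Ω → α) (B : Ω → β) (S : Ω → σ)
    (κ : σ → α → ℝ)
    (hκ : ∀ s a, probEq P (fun ω => (S ω, A ω)) (s, a) = probEq P S s * κ s a) :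
    ∑ ω, P ω * Real.logb 2 (condProbEq P A B (A ω) (B ω) / κ (S ω) (A ω)) =
      mutualInfo P A B - mutualInfo P S A := by
  rw [mutualInfo_eq_sum, mutualInfo_eq_sum, ← Finset.sum_sub_distrib]
  refine Finset.sum_congr rfl fun ω _ => ?_
  rcases (P.2.1 ω).eq_or_lt with h0 | hω
  · have h0' : P ω = 0 := h0.symm
    simp only [h0', zero_mul, sub_zero]
  rw [← mul_sub]
  congr 1
  have hA := hω.trans_le (le_probEq P A ω)
  have hB := hω.trans_le (le_probEq P B ω)
  have hS := hω.trans_le (le_probEq P S ω)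
  have hAB := hω.trans_le (le_probEq P (fun ω => (A ω, B ω)) ω)
  have hSA := hω.trans_le (le_probEq P (fun ω => (S ω, A ω)) ω)
  have hk : 0 < κ (S ω) (A ω) := by
    rw [hκ] at hSA
    exact pos_of_mul_pos_right hSA hS.le
  rw [← Real.logb_div (by positivity) (by positivity), hκ]
  congr 1
  unfold condProbEq
  field_simp

/-- Given `S`, the variable `A` has conditional law `κ`; `B` serves to decode `A`.  Scaling the
likelihood ratio by `2 ^ E` makes its expected logarithm positive as soon as `E` exceeds
`I(S;A) - I(A;B)`. -/
lemma exists_expectation_threshold_le [Fintype α] [Fintype β] [Fintype σ]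
    (P : stdSimplex ℝ Ω) (A : Ω → α) (B : Ω → β) (S : Ω → σ)
    (κ : σ → α → ℝ) (hκ0 : ∀ ω, 0 < P ω → 0 < κ (S ω) (A ω))
    (hκ : ∀ s a, probEq P (fun ω => (S ω, A ω)) (s, a) = probEq P S s * κ s a)
    {E : ℝ} (hE : mutualInfo P S A - mutualInfo P A B < E) :
    ∃ ρ : ℝ, 0 ≤ ρ ∧ ρ < 1 ∧ ∀ n : ℕ,
      ∑ ω : Fin n → Ω, (∏ i, P (ω i)) *
        Real.exp (-((∏ i, 2 ^ E * condProbEq P A B (A (ω i)) (B (ω i))) /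
          ∏ i, κ (S (ω i)) (A (ω i)))) ≤ ρ ^ n := by
  have h2 : (0 : ℝ) < 2 ^ E := Real.rpow_pos_of_pos two_pos _
  have hpos : ∀ ω, 0 < P ω → 0 < condProbEq P A B (A ω) (B ω) / κ (S ω) (A ω) := fun ω hω =>
    div_pos (condProbEq_pos P A B hω) (hκ0 ω hω)
  obtain ⟨ρ, h0, h1, h⟩ := exists_expectation_exp_neg_prod_le P
    (fun ω => 2 ^ E * (condProbEq P A B (A ω) (B ω) / κ (S ω) (A ω)))
    (fun ω hω => mul_pos h2 (hpos ω hω)) (by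
      have hlog := sum_mul_logb_condProbEq_div P A B S κ hκ
      have : ∀ ω, P ω * Real.log (2 ^ E * (condProbEq P A B (A ω) (B ω) / κ (S ω) (A ω))) =
          Real.log 2 * (E * P ω +
            P ω * Real.logb 2 (condProbEq P A B (A ω) (B ω) / κ (S ω) (A ω))) := by
        intro ω
        have hl2 := Real.log_pos one_lt_two
        rcases (P.2.1 ω).eq_or_lt with h0 | hω
        · have h0' : P ω = 0 := h0.symm
          simp only [h0', zero_mul, mul_zero, add_zero]
        · rw [Real.log_mul h2.ne' (hpos ω hω).ne', Real.log_rpow two_pos, Real.logb]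
          field_simp
      simp only [this]
      rw [← Finset.mul_sum, Finset.sum_add_distrib, ← Finset.mul_sum, stdSimplex.sum_eq_one, hlog]
      exact mul_pos (Real.log_pos one_lt_two) (by linarith))
  refine ⟨ρ, h0, h1, fun n => ?_⟩
  refine le_of_eq_of_le (Finset.sum_congr rfl fun ω _ => ?_) (h n)
  rw [← Finset.prod_div_distrib]
  simp only [mul_div_assoc]

end Information

section Marginals

variable {S₁ S₂ X₁ X₂ Y₁ Y₂ U V : Type*} [Fintype S₁] [Fintype S₂] [Fintype X₁] [Fintype X₂]
  [Fintype Y₁] [Fintype Y₂] [Fintype U] [Fintype V]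
  (q : ZICInput S₁ S₂ X₁ X₂ U V) (ch : StateZIC S₁ S₂ X₁ X₂ Y₁ Y₂)

namespace ZICInput

/-- The inputs and outputs are summed out, leaving the states and the auxiliary variables. -/
lemma sum_joint_mul (f : S₁ → S₂ → U → V → ℝ) :
    ∑ ω, q.joint ch ω * f ω.1 ω.2.1 ω.2.2.1 ω.2.2.2.2.1 =
      ∑ s₁, ∑ s₂, ch.state (s₁, s₂) * ∑ u, q.pU s₁ s₂ u * ∑ v, q.pV s₂ v * f s₁ s₂ u v := by
  simp only [Fintype.sum_prod_type]
  refine Finset.sum_congr rfl fun s₁ _ => Finset.sum_congr rfl fun s₂ _ => ?_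
  rw [Finset.mul_sum]
  refine Finset.sum_congr rfl fun u _ => ?_
  have hJ : ∀ x₁ v x₂ y₁ y₂, q.joint ch (s₁, s₂, u, x₁, v, x₂, y₁, y₂) * f s₁ s₂ u v =
      ch.state (s₁, s₂) * (q.pU s₁ s₂ u * (q.pX₁ u s₁ s₂ x₁ * (q.pV s₂ v * f s₁ s₂ u v *
        (q.pX₂ v s₂ x₂ * (ch.chan₁ s₁ x₁ x₂ y₁ * ch.chan₂ s₂ x₂ y₂))))) := fun x₁ v x₂ y₁ y₂ => by
    change ch.state (s₁, s₂) * (q.pU s₁ s₂ u * (q.pX₁ u s₁ s₂ x₁ * (q.pV s₂ v *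
        (q.pX₂ v s₂ x₂ * (ch.chan₁ s₁ x₁ x₂ y₁ * ch.chan₂ s₂ x₂ y₂))))) * _ = _
    ring
  simp only [hJ, ← Finset.mul_sum, stdSimplex.sum_eq_one, mul_one, ← Finset.sum_mul, one_mul]

lemma probEq_S₁S₂_U (s : S₁ × S₂) (u : U) :
    probEq (q.joint ch) (fun ω => ((ω.1, ω.2.1), ω.2.2.1)) (s, u) =
      probEq (q.joint ch) (fun ω => (ω.1, ω.2.1)) s * q.pU s.1 s.2 u := by
  classical
  obtain ⟨σ₁, σ₂⟩ := s
  have h1 := q.sum_joint_mul ch fun s₁ s₂ u' _ => if ((s₁, s₂), u') = ((σ₁, σ₂), u) then 1 else 0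
  have h2 := q.sum_joint_mul ch fun s₁ s₂ _ _ => if (s₁, s₂) = (σ₁, σ₂) then 1 else 0
  simp only [← Finset.sum_mul, stdSimplex.sum_eq_one, one_mul] at h1 h2
  simp only [mul_ite, mul_one, mul_zero] at h1 h2
  have h3 : (∑ s₁, ∑ s₂, ch.state (s₁, s₂) * ∑ u', if ((s₁, s₂), u') = ((σ₁, σ₂), u) then
      q.pU s₁ s₂ u' else 0) = ch.state (σ₁, σ₂) * q.pU σ₁ σ₂ u := by
    simp [ite_and, Finset.sum_ite_irrel]
  have h4 : (∑ s₁, ∑ s₂, if (s₁, s₂) = (σ₁, σ₂) then ch.state (s₁, s₂) else 0)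
      = ch.state (σ₁, σ₂) := by
    simp [ite_and, Finset.sum_ite_irrel]
  rw [h3] at h1
  rw [h4] at h2
  rw [← h2] at h1
  unfold probEq
  convert h1

lemma probEq_S₂_V (s : S₂) (v : V) :
    probEq (q.joint ch) (fun ω => (ω.2.1, ω.2.2.2.2.1)) (s, v) =
      probEq (q.joint ch) (fun ω => ω.2.1) s * q.pV s v := by
  classical
  have h1 := q.sum_joint_mul ch fun _ s₂ _ v' => if (s₂, v') = (s, v) then 1 else 0
  have h2 := q.sum_joint_mul ch fun _ s₂ _ _ => if s₂ = s then 1 else 0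
  simp only [← Finset.sum_mul, stdSimplex.sum_eq_one, one_mul] at h1 h2
  simp only [mul_ite, mul_one, mul_zero] at h1 h2
  have h3 : (∑ s₁, ∑ s₂, ch.state (s₁, s₂) * ∑ v', if (s₂, v') = (s, v) then
      q.pV s₂ v' else 0) = (∑ s₁, ch.state (s₁, s)) * q.pV s v := by
    simp [ite_and, Finset.sum_ite_irrel, Finset.sum_mul]
  have h4 : (∑ s₁, ∑ s₂, if s₂ = s then ch.state (s₁, s₂) else 0)
      = ∑ s₁, ch.state (s₁, s) := by
    simp
  rw [h3] at h1
  rw [h4] at h2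
  rw [← h2] at h1
  unfold probEq
  convert h1

end ZICInput

end Marginals

/-! ### Rates and achievability -/

section Rates

lemma ceil_two_rpow_sub_one_le (n : ℕ) (R : ℝ) :
    (⌈(2 : ℝ) ^ ((n : ℝ) * R)⌉₊ : ℝ) - 1 ≤ ((2 : ℝ) ^ R) ^ n := by
  have h := Nat.ceil_lt_add_one (Real.rpow_nonneg zero_le_two ((n : ℝ) * R))
  have h2 : ((2 : ℝ) ^ R) ^ n = (2 : ℝ) ^ ((n : ℝ) * R) := by
    rw [mul_comm, Real.rpow_mul zero_le_two, Real.rpow_natCast]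
  linarith

lemma ceil_two_rpow_le (n : ℕ) {R : ℝ} (hR : 0 ≤ R) :
    (⌈(2 : ℝ) ^ ((n : ℝ) * R)⌉₊ : ℝ) ≤ 2 * ((2 : ℝ) ^ R) ^ n := by
  have h := ceil_two_rpow_sub_one_le n R
  have h1 : 1 ≤ ((2 : ℝ) ^ R) ^ n := one_le_pow₀ (Real.one_le_rpow one_le_two hR)
  linarith

lemma ceil_two_rpow_pos (n : ℕ) (R : ℝ) : 0 < ⌈(2 : ℝ) ^ ((n : ℝ) * R)⌉₊ :=
  Nat.ceil_pos.2 (Real.rpow_pos_of_pos two_pos _)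

lemma tendsto_two_rpow_pow {E : ℝ} (hE : E < 0) :
    Tendsto (fun n : ℕ => ((2 : ℝ) ^ E) ^ n) atTop (𝓝 0) :=
  tendsto_pow_atTop_nhds_zero_of_lt_one (Real.rpow_nonneg zero_le_two _)
    (Real.rpow_lt_one_of_one_lt_of_neg one_lt_two hE)

/-- A rate of exactly zero means a single message, hence no wrong messages at all. -/
lemma tendsto_wrong_messages {R G : ℝ} (h : R = 0 ∨ R + G < 0) :
    Tendsto (fun n : ℕ => ((⌈(2 : ℝ) ^ ((n : ℝ) * R)⌉₊ : ℝ) - 1) * ((2 : ℝ) ^ G) ^ n)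
      atTop (𝓝 0) := by
  rcases h with rfl | h
  · simp
  refine squeeze_zero (fun n => mul_nonneg (sub_nonneg.2 ?_) (by positivity)) (fun n => ?_)
    (tendsto_two_rpow_pow h)
  · exact_mod_cast ceil_two_rpow_pos n R
  · rw [Real.rpow_add two_pos, mul_pow]
    exact mul_le_mul_of_nonneg_right (ceil_two_rpow_sub_one_le n R) (by positivity)

lemma tendsto_wrong_messages_pair {R₁ R₂ A B : ℝ} (hR₂ : 0 ≤ R₂)
    (h : R₁ = 0 ∨ (R₁ + B < 0 ∧ R₁ + B + (R₂ + A) < 0)) :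
    Tendsto (fun n : ℕ => ((⌈(2 : ℝ) ^ ((n : ℝ) * R₁)⌉₊ : ℝ) - 1) * ((2 : ℝ) ^ B) ^ n *
      (1 + ⌈(2 : ℝ) ^ ((n : ℝ) * R₂)⌉₊ * ((2 : ℝ) ^ A) ^ n)) atTop (𝓝 0) := by
  have h1 := tendsto_wrong_messages (R := R₁) (G := B) (h.imp id And.left)
  have h2 := (tendsto_wrong_messages (R := R₁) (G := B + (R₂ + A))
    (h.imp id fun h => by linarith [h.2])).const_mul 2
  have h3 := h1.add h2
  rw [mul_zero, add_zero] at h3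
  have hM : ∀ n : ℕ, (0 : ℝ) ≤ (⌈(2 : ℝ) ^ ((n : ℝ) * R₁)⌉₊ : ℝ) - 1 := fun n =>
    sub_nonneg.2 (by exact_mod_cast ceil_two_rpow_pos n R₁)
  refine squeeze_zero (fun n => mul_nonneg (mul_nonneg (hM n) (by positivity)) (by positivity))
    (fun n => ?_) h3
  have hB : (0 : ℝ) ≤ ((2 : ℝ) ^ B) ^ n := by positivity
  have hA : (0 : ℝ) ≤ ((2 : ℝ) ^ A) ^ n := by positivity
  rw [Real.rpow_add two_pos B, Real.rpow_add two_pos R₂, mul_pow, mul_pow]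
  have h4 := mul_le_mul_of_nonneg_left (mul_le_mul_of_nonneg_right (ceil_two_rpow_le n hR₂) hA)
    (mul_nonneg (hM n) hB)
  calc _ = ((⌈(2 : ℝ) ^ ((n : ℝ) * R₁)⌉₊ : ℝ) - 1) * ((2 : ℝ) ^ B) ^ n +
        ((⌈(2 : ℝ) ^ ((n : ℝ) * R₁)⌉₊ : ℝ) - 1) * ((2 : ℝ) ^ B) ^ n *
          (⌈(2 : ℝ) ^ ((n : ℝ) * R₂)⌉₊ * ((2 : ℝ) ^ A) ^ n) := by ring
    _ ≤ _ := add_le_add_right h4 _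
    _ = _ := by ring

end Rates

section Achievability

lemma sum_prod_condProbEq_le {Ω α β : Type*} [Fintype Ω] [Fintype α] (P : stdSimplex ℝ Ω)
    (A : Ω → α) (B : Ω → β) {t : ℝ} (ht : 0 ≤ t) {n : ℕ} (y : Fin n → β) :
    ∑ x : Fin n → α, ∏ i, t * condProbEq P A B (x i) (y i) ≤ t ^ n := by
  rw [← Fintype.prod_sum fun i x => t * condProbEq P A B x (y i)]
  calc _ ≤ ∏ _i : Fin n, t := by
        refine Finset.prod_le_prod (fun i _ => Finset.sum_nonneg fun x _ =>
          mul_nonneg ht (condProbEq_nonneg _ _ _ _ _)) fun i _ => ?_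
        rw [← Finset.mul_sum]
        exact mul_le_of_le_one_right ht (sum_condProbEq_le_one P A B (y i))
    _ = t ^ n := by simp

lemma StateZIC.errorProb_nonneg {S₁ S₂ X₁ X₂ Y₁ Y₂ : Type*} [Fintype S₁] [Fintype S₂]
    [Fintype Y₁] [Fintype Y₂] (ch : StateZIC S₁ S₂ X₁ X₂ Y₁ Y₂) {n M₁ M₂ : ℕ}
    (c : ZICCode S₁ S₂ X₁ X₂ Y₁ Y₂ n M₁ M₂) : 0 ≤ ch.errorProb c := by
  refine mul_nonneg (by positivity) (Finset.sum_nonneg fun w₁ _ => Finset.sum_nonneg fun w₂ _ =>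
    Finset.sum_nonneg fun s₁ _ => Finset.sum_nonneg fun s₂ _ => mul_nonneg
      (Finset.prod_nonneg fun i _ => ch.state.2.1 _) (Finset.sum_nonneg fun y₁ _ =>
        Finset.sum_nonneg fun y₂ _ => mul_nonneg (mul_nonneg
          (Finset.prod_nonneg fun i _ => (ch.chan₁ _ _ _).2.1 _)
          (Finset.prod_nonneg fun i _ => (ch.chan₂ _ _).2.1 _)) ?_))
  split_ifs
  exacts [zero_le_one, le_rfl]

variable {S₁ S₂ X₁ X₂ Y₁ Y₂ U V : Type*} [Fintype S₁] [Fintype S₂] [Fintype X₁] [Fintype X₂]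
  [Fintype Y₁] [Fintype Y₂] [Fintype U] [Fintype V]

lemma ZICInput.pU_pos_of_joint_pos (q : ZICInput S₁ S₂ X₁ X₂ U V)
    (ch : StateZIC S₁ S₂ X₁ X₂ Y₁ Y₂) (ω : S₁ × S₂ × U × X₁ × V × X₂ × Y₁ × Y₂)
    (h : 0 < q.joint ch ω) : 0 < q.pU ω.1 ω.2.1 ω.2.2.1 := by
  refine lt_of_le_of_ne ((q.pU _ _).2.1 _) fun h0 => h.ne' ?_
  change ch.state (ω.1, ω.2.1) * (q.pU ω.1 ω.2.1 ω.2.2.1 * _) = 0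
  rw [show q.pU ω.1 ω.2.1 ω.2.2.1 = 0 from h0.symm, zero_mul, mul_zero]

lemma ZICInput.pV_pos_of_joint_pos (q : ZICInput S₁ S₂ X₁ X₂ U V)
    (ch : StateZIC S₁ S₂ X₁ X₂ Y₁ Y₂) (ω : S₁ × S₂ × U × X₁ × V × X₂ × Y₁ × Y₂)
    (h : 0 < q.joint ch ω) : 0 < q.pV ω.2.1 ω.2.2.2.2.1 := by
  refine lt_of_le_of_ne ((q.pV _).2.1 _) fun h0 => h.ne' ?_
  change ch.state (ω.1, ω.2.1) * (q.pU ω.1 ω.2.1 ω.2.2.1 * (q.pX₁ ω.2.2.1 ω.1 ω.2.1 ω.2.2.2.1 *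
    (q.pV ω.2.1 ω.2.2.2.2.1 * _))) = 0
  rw [show q.pV ω.2.1 ω.2.2.2.2.1 = 0 from h0.symm, zero_mul, mul_zero, mul_zero, mul_zero]

/-- The one-shot coding theorem applied to the block channel. -/
lemma StateZIC.exists_block_code (ch : StateZIC S₁ S₂ X₁ X₂ Y₁ Y₂) {n : ℕ}
    (q : ZICInput (Fin n → S₁) (Fin n → S₂) (Fin n → X₁) (Fin n → X₂) (Fin n → U) (Fin n → V))
    {M₁ M₂ : ℕ} (hM₁ : 0 < M₁) (hM₂ : 0 < M₂)
    {a : (Fin n → V) → (Fin n → Y₁) → ℝ} {b : (Fin n → U) → (Fin n → V) → (Fin n → Y₁) → ℝ}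
    {c : (Fin n → V) → (Fin n → Y₂) → ℝ}
    (ha : ∀ v y, 0 ≤ a v y) (hb : ∀ u v y, 0 ≤ b u v y) (hc : ∀ v y, 0 ≤ c v y)
    {α β γ : ℝ} (hα : ∀ y, ∑ v, a v y ≤ α) (hβ : ∀ v y, ∑ u, b u v y ≤ β)
    (hγ : ∀ y, ∑ v, c v y ≤ γ) (hβ0 : 0 ≤ β) :
    ∃ C : ZICCode S₁ S₂ X₁ X₂ Y₁ Y₂ n M₁ M₂, ch.errorProb C ≤
      ∑ ω, q.joint (ch.block n) ω * q.missProb a b c ω +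
      (((M₁ : ℝ) - 1) * β * (1 + M₂ * α) + ((M₂ : ℝ) - 1) * γ) := by
  obtain ⟨e₁, e₂, d₁, d₂, h⟩ := exists_oneShot_code (ch.block n) q hM₁ hM₂ ha hb hc hα hβ hγ hβ0
  exact ⟨⟨e₁, e₂, d₁, d₂⟩, h⟩

/-- Memoryless random coding with threshold exponents `A` and `B` for `V` and `U` at the first
decoder and `G` for `V` at the second.  The exponents must be large enough for the transmitted
codewords to pass, and small enough for wrong codewords not to.  The conditions on the wrong
codewords are void for a user with a single message; in particular `R₂ + A` may be positive. -/
theorem StateZIC.achievable_of_exponents (ch : StateZIC S₁ S₂ X₁ X₂ Y₁ Y₂)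
    (q : ZICInput S₁ S₂ X₁ X₂ U V) {R₁ R₂ A B G : ℝ} (hR₁ : 0 ≤ R₁) (hR₂ : 0 ≤ R₂)
    (hA : q.infoS₂_V ch - q.infoV_Y₁ ch < A) (hB : q.infoS₁S₂_U ch - q.infoU_VY₁ ch < B)
    (hG : q.infoS₂_V ch - q.infoV_Y₂ ch < G)
    (h₁ : R₁ = 0 ∨ (R₁ + B < 0 ∧ R₁ + B + (R₂ + A) < 0)) (h₂ : R₂ = 0 ∨ R₂ + G < 0) :
    ch.Achievable R₁ R₂ := by
  set J := q.joint ch with hJ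
  obtain ⟨ρ₁, hρ₁, hρ₁', hbd₁⟩ := exists_expectation_threshold_le J (fun ω => ω.2.2.2.2.1)
    (fun ω => ω.2.2.2.2.2.2.1) (fun ω => ω.2.1) (fun s v => q.pV s v)
    (q.pV_pos_of_joint_pos ch) (q.probEq_S₂_V ch) (E := A) hA
  obtain ⟨ρ₂, hρ₂, hρ₂', hbd₂⟩ := exists_expectation_threshold_le J (fun ω => ω.2.2.1)
    (fun ω => (ω.2.2.2.2.1, ω.2.2.2.2.2.2.1)) (fun ω => (ω.1, ω.2.1))
    (fun s u => q.pU s.1 s.2 u)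
    (q.pU_pos_of_joint_pos ch) (q.probEq_S₁S₂_U ch) (E := B) hB
  obtain ⟨ρ₃, hρ₃, hρ₃', hbd₃⟩ := exists_expectation_threshold_le J (fun ω => ω.2.2.2.2.1)
    (fun ω => ω.2.2.2.2.2.2.2) (fun ω => ω.2.1) (fun s v => q.pV s v)
    (q.pV_pos_of_joint_pos ch) (q.probEq_S₂_V ch) (E := G) hG
  have h2 : ∀ E : ℝ, (0 : ℝ) ≤ 2 ^ E := fun E => Real.rpow_nonneg zero_le_two E
  have hcode : ∀ n : ℕ, ∃ c : ZICCode S₁ S₂ X₁ X₂ Y₁ Y₂ n ⌈(2 : ℝ) ^ ((n : ℝ) * R₁)⌉₊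
      ⌈(2 : ℝ) ^ ((n : ℝ) * R₂)⌉₊, ch.errorProb c ≤ (ρ₁ ^ n + ρ₂ ^ n + ρ₃ ^ n) +
        (((⌈(2 : ℝ) ^ ((n : ℝ) * R₁)⌉₊ : ℝ) - 1) * ((2 : ℝ) ^ B) ^ n *
          (1 + ⌈(2 : ℝ) ^ ((n : ℝ) * R₂)⌉₊ * ((2 : ℝ) ^ A) ^ n) +
         ((⌈(2 : ℝ) ^ ((n : ℝ) * R₂)⌉₊ : ℝ) - 1) * ((2 : ℝ) ^ G) ^ n) := by
    intro n
    obtain ⟨C, hC⟩ := ch.exists_block_code (q.block n)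
      (ceil_two_rpow_pos n R₁) (ceil_two_rpow_pos n R₂)
      (a := fun v y => ∏ i, 2 ^ A * condProbEq J (fun ω => ω.2.2.2.2.1)
        (fun ω => ω.2.2.2.2.2.2.1) (v i) (y i))
      (b := fun u v y => ∏ i, 2 ^ B * condProbEq J (fun ω => ω.2.2.1)
        (fun ω => (ω.2.2.2.2.1, ω.2.2.2.2.2.2.1)) (u i) (v i, y i))
      (c := fun v y => ∏ i, 2 ^ G * condProbEq J (fun ω => ω.2.2.2.2.1)
        (fun ω => ω.2.2.2.2.2.2.2) (v i) (y i))
      (fun v y => Finset.prod_nonneg fun i _ => mul_nonneg (h2 A) (condProbEq_nonneg _ _ _ _ _))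
      (fun u v y => Finset.prod_nonneg fun i _ => mul_nonneg (h2 B) (condProbEq_nonneg _ _ _ _ _))
      (fun v y => Finset.prod_nonneg fun i _ => mul_nonneg (h2 G) (condProbEq_nonneg _ _ _ _ _))
      (α := (2 ^ A) ^ n) (β := (2 ^ B) ^ n) (γ := (2 ^ G) ^ n)
      (fun y => sum_prod_condProbEq_le _ _ _ (h2 A) y)
      (fun v y => sum_prod_condProbEq_le _ _ _ (h2 B) fun i => (v i, y i))
      (fun y => sum_prod_condProbEq_le _ _ _ (h2 G) y) (pow_nonneg (h2 B) n)
    refine ⟨C, hC.trans (add_le_add_left ?_ _)⟩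
    rw [q.sum_joint_block ch]
    refine le_trans (le_of_eq ?_) (add_le_add (add_le_add (hbd₁ n) (hbd₂ n)) (hbd₃ n))
    rw [← Finset.sum_add_distrib, ← Finset.sum_add_distrib]
    refine Finset.sum_congr rfl fun ω _ => ?_
    rw [← mul_add, ← mul_add]
    rfl
  choose c hc using hcode
  refine ⟨hR₁, hR₂, c, squeeze_zero (fun n => ch.errorProb_nonneg _) hc ?_⟩
  have t : ∀ {ρ : ℝ}, 0 ≤ ρ → ρ < 1 → Tendsto (fun n : ℕ => ρ ^ n) atTop (𝓝 0) :=
    fun h h' => tendsto_pow_atTop_nhds_zero_of_lt_one h h'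
  simpa using (((t hρ₁ hρ₁').add (t hρ₂ hρ₂')).add (t hρ₃ hρ₃')).add
    ((tendsto_wrong_messages_pair hR₂ h₁).add (tendsto_wrong_messages h₂))

theorem StateZIC.achievable_of_lt (ch : StateZIC S₁ S₂ X₁ X₂ Y₁ Y₂)
    (q : ZICInput S₁ S₂ X₁ X₂ U V) {R₁ R₂ : ℝ} (hR₁ : 0 ≤ R₁) (hR₂ : 0 ≤ R₂)
    (h₁ : R₁ < q.infoU_VY₁ ch - q.infoS₁S₂_U ch)
    (h₂ : R₂ < min (q.infoV_Y₂ ch) (q.infoV_Y₁ ch) - q.infoS₂_V ch) :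
    ch.Achievable R₁ R₂ := by
  have h3 := min_le_left (q.infoV_Y₂ ch) (q.infoV_Y₁ ch)
  have h4 := min_le_right (q.infoV_Y₂ ch) (q.infoV_Y₁ ch)
  obtain ⟨A, hA, hA'⟩ := exists_between
    (show q.infoS₂_V ch - q.infoV_Y₁ ch < -R₂ by linarith)
  obtain ⟨B, hB, hB'⟩ := exists_between
    (show q.infoS₁S₂_U ch - q.infoU_VY₁ ch < -R₁ by linarith)
  obtain ⟨G, hG, hG'⟩ := exists_between
    (show q.infoS₂_V ch - q.infoV_Y₂ ch < -R₂ by linarith)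
  exact ch.achievable_of_exponents q hR₁ hR₂ hA hB hG
    (Or.inr ⟨by linarith, by linarith⟩) (Or.inr (by linarith))

/-- Boundary pairs are approximated by lowering the positive rates only.  Lowering `R₁` by `ε`
leaves room for the exponent of the interfering codeword to exceed `-R₂` slightly. -/
theorem StateZIC.mem_capacityRegion_of_le (ch : StateZIC S₁ S₂ X₁ X₂ Y₁ Y₂)
    (q : ZICInput S₁ S₂ X₁ X₂ U V) {R₁ R₂ : ℝ} (hR₁ : 0 ≤ R₁) (hR₂ : 0 ≤ R₂)
    (h₁ : R₁ ≤ q.infoU_VY₁ ch - q.infoS₁S₂_U ch)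
    (h₂ : R₂ ≤ min (q.infoV_Y₂ ch) (q.infoV_Y₁ ch) - q.infoS₂_V ch) :
    (R₁, R₂) ∈ ch.capacityRegion := by
  have h3 := min_le_left (q.infoV_Y₂ ch) (q.infoV_Y₁ ch)
  have h4 := min_le_right (q.infoV_Y₂ ch) (q.infoV_Y₁ ch)
  have hlim : ∀ R : ℝ, Tendsto (fun ε : ℝ => if R = 0 then 0 else R - ε) (𝓝[>] 0) (𝓝 R) := by
    intro R
    split_ifs with h
    · rw [h]; exact tendsto_const_nhds
    · have : Tendsto (fun ε : ℝ => R - ε) (𝓝 0) (𝓝 (R - 0)) :=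
        (continuous_const.sub continuous_id).tendsto 0
      rw [sub_zero] at this
      exact this.mono_left nhdsWithin_le_nhds
  have hsmall : ∀ R : ℝ, 0 ≤ R → ∀ᶠ ε in 𝓝[>] (0 : ℝ), 0 ≤ if R = 0 then 0 else R - ε := by
    intro R hR
    split_ifs with h
    · exact Eventually.of_forall fun _ => le_rfl
    · have : ∀ᶠ ε in 𝓝[>] (0 : ℝ), ε < R := eventually_nhdsWithin_of_eventually_nhds
        (eventually_lt_nhds (lt_of_le_of_ne hR (Ne.symm h)))
      exact this.mono fun ε hε => by linarith
  refine mem_closure_of_tendsto ((hlim R₁).prodMk_nhds (hlim R₂)) ?_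
  filter_upwards [hsmall R₁ hR₁, hsmall R₂ hR₂, self_mem_nhdsWithin] with ε hε₁ hε₂ hε
  have hε : 0 < ε := hε
  have hle : (if R₂ = 0 then 0 else R₂ - ε) ≤ R₂ := by split_ifs <;> linarith
  refine ch.achievable_of_exponents q hε₁ hε₂
    (A := q.infoS₂_V ch - q.infoV_Y₁ ch + ε / 3)
    (B := q.infoS₁S₂_U ch - q.infoU_VY₁ ch + ε / 3)
    (G := q.infoS₂_V ch - q.infoV_Y₂ ch + ε / 3) (by linarith) (by linarith) (by linarith) ?_ ?_
  · by_cases h : R₁ = 0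
    · exact Or.inl (if_pos h)
    · right
      simp only [if_neg h]
      constructor <;> linarith
  · by_cases h : R₂ = 0
    · exact Or.inl (if_pos h)
    · right
      rw [if_neg h]
      linarith

end Achievability

theorem proposition2 {S₁ S₂ X₁ X₂ Y₁ Y₂ U V : Type*}
    [Fintype S₁] [Fintype S₂] [Fintype X₁] [Fintype X₂] [Fintype Y₁] [Fintype Y₂]
    [Fintype U] [Fintype V]
    (ch : StateZIC S₁ S₂ X₁ X₂ Y₁ Y₂) (q : ZICInput S₁ S₂ X₁ X₂ U V) :
    ((∀ R₁ R₂ : ℝ, 0 ≤ R₁ → 0 ≤ R₂ →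
        R₁ < q.infoU_VY₁ ch - q.infoS₁S₂_U ch →
        R₂ < min (q.infoV_Y₂ ch) (q.infoV_Y₁ ch) - q.infoS₂_V ch →
        ch.Achievable R₁ R₂) ∧
      (∀ R₁ R₂ : ℝ, 0 ≤ R₁ → 0 ≤ R₂ →
        R₁ ≤ q.infoU_VY₁ ch - q.infoS₁S₂_U ch →
        R₂ ≤ min (q.infoV_Y₂ ch) (q.infoV_Y₁ ch) - q.infoS₂_V ch →
        (R₁, R₂) ∈ ch.capacityRegion)) ∧
    (q.infoV_Y₂ ch ≤ q.infoV_Y₁ ch →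
      (∀ R₁ R₂ : ℝ, 0 ≤ R₁ → 0 ≤ R₂ →
        R₁ < q.infoU_VY₁ ch - q.infoS₁S₂_U ch →
        R₂ < q.infoV_Y₂ ch - q.infoS₂_V ch →
        ch.Achievable R₁ R₂) ∧
      (∀ R₁ R₂ : ℝ, 0 ≤ R₁ → 0 ≤ R₂ →
        R₁ ≤ q.infoU_VY₁ ch - q.infoS₁S₂_U ch →
        R₂ ≤ q.infoV_Y₂ ch - q.infoS₂_V ch →
        (R₁, R₂) ∈ ch.capacityRegion)) := by

  refine ⟨⟨fun _ _ hR₁ hR₂ => ch.achievable_of_lt q hR₁ hR₂,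
    fun _ _ hR₁ hR₂ => ch.mem_capacityRegion_of_le q hR₁ hR₂⟩, fun h => ?_⟩
  have hmin := min_eq_left h
  exact ⟨fun _ _ hR₁ hR₂ h₁ h₂ => ch.achievable_of_lt q hR₁ hR₂ h₁ (by rwa [hmin]),
    fun _ _ hR₁ hR₂ h₁ h₂ => ch.mem_capacityRegion_of_le q hR₁ hR₂ h₁ (by rwa [hmin])⟩
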